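/- **Conventions.** All spaces are real. A *product* on a Banach lattice $X$ is an associative bilinear map $P\colon X\times X\to X$ with $P(x,y)\ge 0$ whenever $x,y\ge 0$ (such a map is automatically bounded); $X$ with $P$ is a *Banach lattice algebra* if moreover $\|P(x,y)\|\le\|x\|\,\|y\|$ for all $x,y\in X$. A net $(e_\alpha)$ is an *approximate algebraic identity* for $P$ if $P(e_\alpha,x)\to x$ and $P(x,e_\alpha)\to x$ in norm for every $x\in X$. A product $P$ is an *AM-algebra product* on $X$ if it makes $X$ a Banach lattice algebra and there is a net $(e_\alpha)\subseteq X_+$ that is an approximate algebraic identity for $P$ and satisfies $x^*(e_\alpha)\to\|x^*\|$ for every positive $x^*\in X^*$. The Banach lattice $X$ is an *AM-algebra* if it has an AM-algebra product (which is then unique). An *order unit* of a Banach lattice $X$ is an element $e\in X$ with $B_X=[-e,e]$, where $B_X$ is the closed unit ball; a Banach lattice algebra is an *AM-algebra with unit* if it has an order unit that is also a two-sided algebraic identity. Write $(B_X)_+=\{x\in X: x\ge 0,\ \|x\|\le 1\}$, regarded as a net indexed by itself with the order of $X$. Let $K_X^*$ be the set of nonzero lattice homomorphisms $x^*\colon X\to\mathbb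 R$ with $\|x^*\|\le 1$, and $K_X^1$ the set of those with $\|x^*\|=1$. For a bounded bilinear map $P\colon A\times B\to C$ of Banach spaces let $P^*\colon C^*\times A\to B^*$ be given by $P^*(\phi,a)(b)=\phi(P(a,b))$ and, when $A=B=C$, let $P^t(b,a)=P(a,b)$; the first and second Arens products on $X^{**}$ are $P^{***}$ and $P^{t***t}$. The bidual $X^{**}$ carries its usual order and norm. A *lattice-algebra isometry* is a linear isometry preserving the lattice operations and the products; spaces of continuous real functions carry the pointwise operations and the supremum norm. Here $C_0(\Omega)$ is the space of continuous real functions on $\Omega$ that vanish at infinity. Subalgebras need not contain the constant functions. **Theorem.** Let $X$ be an AM-algebra and let $P$ be a product on $X$. The following are equivalent: 1. $P$ is the AM-algebra product on $X$. 2. The net $(B_X)_+$ is an approximate algebraic identity for $P$. 3. Identifying each $x\in X$ with the function $x^*\mapsto x^*(x)$, the product is given by $P(f,g)(x^*)=\frac{1}{\|x^*\|}f(x^*)g(x^*)$; that is, $x^*(P(x,y))=\frac{1}{\|x^*\|}x^*(x)\,x^*(y)$ for all $x,y\in X$ and $x^*\in K_X^*$. 4. $z^*(P(x,y))=z^*(x)z^*(y)$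 for all $z^*\in K_X^1$ and $x,y\in X$. 5. $X$ with the product $P$ is lattice-algebra isometric to a closed subalgebra of $C(K)$ for some compact Hausdorff space $K$. 6. $X$ with the product $P$ is lattice-algebra isometric to a closed ideal of $C(K)$ for some compact Hausdorff space $K$. 7. $X$ with the product $P$ is lattice-algebra isometric to $C_0(\Omega)$ for some locally compact Hausdorff space $\Omega$. 8. The two Arens products on $X^{**}$ induced by $P$ coincide and make $X^{**}$ an AM-algebra with unit. 9. There are a compact Hausdorff space $K$ and a surjective linear lattice isometry $J\colon X^{**}\to C(K)$ such that, with $\iota\colon X\to X^{**}$ the canonical inclusion, $J\iota(P(x,y))=J\iota(x)\cdot J\iota(y)$ (pointwise product) for all $x,y\in X$. If $e\in X$ is an order unit of $X$ (that is, $X$ is an AM-space with unit $e$), then these are also equivalent to each of: 10. $e$ is the two-sided algebraic identity of $P$. 11. There are a compact Hausdorff space $K$ and a surjective linear lattice isometry of $X$ onto $C(K)$ carrying $P$ to the pointwise product of $C(K)$. -/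

import Mathlib

open Filter Topology

universe u

set_option maxSynthPendingDepth 3

namespace AMAlg

section Order

variable {E : Type*} [NormedAddCommGroup E] [NormedSpace ℝ E] [Preorder E]

/-- The usual order of the dual space: `φ ≤ ψ` iff `φ x ≤ ψ x` for all `x ≥ 0`. Used twice, it gives
the usual order of the bidual. -/
instance dualPreorder : Preorder (StrongDual ℝ E) where
  le φ ψ := ∀ x : E, 0 ≤ x → φ x ≤ ψ x
  le_refl _ _ _ := le_rfl
  le_trans _ _ _ h₁ h₂ x hx := (h₁ x hx).trans (h₂ x hx)

/-- `e` is the order unit of an AM-space with unit: the closed unit ball is the order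
interval `[-e, e]`. (In a vector lattice, `|x| ≤ e` iff `-e ≤ x` and `x ≤ e`.) -/
def IsOrderUnit (e : E) : Prop :=
  ∀ x : E, ‖x‖ ≤ 1 ↔ -e ≤ x ∧ x ≤ e

/-- The bilinear map `P` is the product of a vector lattice algebra: it is associative and products
of positive elements are positive. -/
structure IsLatticeAlgebraProduct (P : E →ₗ[ℝ] E →ₗ[ℝ] E) : Prop where
  assoc : ∀ x y z : E, P (P x y) z = P x (P y z)
  pos : ∀ x y : E, 0 ≤ x → 0 ≤ y → 0 ≤ P x y

/-- The product of a Banach lattice algebra: moreover, the norm is submultiplicative. -/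
structure IsBanachLatticeAlgebraProduct (P : E →ₗ[ℝ] E →ₗ[ℝ] E) : Prop
    extends IsLatticeAlgebraProduct P where
  submul : ∀ x y : E, ‖P x y‖ ≤ ‖x‖ * ‖y‖

/-- `e` is a two-sided algebraic identity of `P`. -/
def IsAlgIdentity (P : E →ₗ[ℝ] E →ₗ[ℝ] E) (e : E) : Prop :=
  ∀ x : E, P e x = x ∧ P x e = x

/-- The net `e` is an approximate algebraic identity for `P`. -/
def IsApproxIdentity {ι : Type*} [Preorder ι] (P : E →ₗ[ℝ] E →ₗ[ℝ] E) (e : ι → E) : Prop :=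
  ∀ x : E, Tendsto (fun i => P (e i) x) atTop (𝓝 x) ∧ Tendsto (fun i => P x (e i)) atTop (𝓝 x)

/-- The net `e` is an approximate order unit: it is positive, and `φ (e i) → ‖φ‖` for every
positive functional `φ`. -/
def IsApproxOrderUnit {ι : Type*} [Preorder ι] (e : ι → E) : Prop :=
  (∀ i, 0 ≤ e i) ∧
    ∀ φ : StrongDual ℝ E, 0 ≤ φ → Tendsto (fun i => φ (e i)) atTop (𝓝 ‖φ‖)

/-- `P` makes `E` into an AM-algebra with unit. -/
def IsUnitalAMAlgebraProduct (P : E →ₗ[ℝ] E →ₗ[ℝ] E) : Prop :=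
  IsBanachLatticeAlgebraProduct P ∧ ∃ e : E, IsOrderUnit e ∧ IsAlgIdentity P e

end Order

section Dual

variable {A B C : Type*} [NormedAddCommGroup A] [NormedSpace ℝ A] [NormedAddCommGroup B]
  [NormedSpace ℝ B] [NormedAddCommGroup C] [NormedSpace ℝ C]

/-- The Arens adjoint `P* : C* × A → B*` of a bounded bilinear map `P : A × B → C`. -/
noncomputable def arensAdjoint (P : A →L[ℝ] B →L[ℝ] C) :
    StrongDual ℝ C →L[ℝ] A →L[ℝ] StrongDual ℝ B :=
  ((ContinuousLinearMap.compL ℝ A (B →L[ℝ] C) (B →L[ℝ] ℝ)).flip P).comp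
    (ContinuousLinearMap.compL ℝ B C ℝ)

theorem arensAdjoint_apply (P : A →L[ℝ] B →L[ℝ] C) (φ : StrongDual ℝ C) (a : A) (b : B) :
    arensAdjoint P φ a b = φ (P a b) := rfl

/-- The first Arens product `P***` on the bidual. -/
noncomputable def firstArens (P : A →L[ℝ] A →L[ℝ] A) :
    StrongDual ℝ (StrongDual ℝ A) →L[ℝ] StrongDual ℝ (StrongDual ℝ A) →L[ℝ]
      StrongDual ℝ (StrongDual ℝ A) :=
  arensAdjoint (arensAdjoint (arensAdjoint P))

/-- The second Arens product `P^{t***t}` on the bidual. -/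
noncomputable def secondArens (P : A →L[ℝ] A →L[ℝ] A) :
    StrongDual ℝ (StrongDual ℝ A) →L[ℝ] StrongDual ℝ (StrongDual ℝ A) →L[ℝ]
      StrongDual ℝ (StrongDual ℝ A) :=
  (firstArens P.flip).flip

end Dual

section BanachLattice

variable {X : Type u} [NormedAddCommGroup X] [NormedSpace ℝ X] [Lattice X]

/-- `P` makes `X` into an AM-algebra with approximate unit. -/
def IsAMAlgebraProduct (P : X →ₗ[ℝ] X →ₗ[ℝ] X) : Prop :=
  IsBanachLatticeAlgebraProduct P ∧
    ∃ (ι : Type u) (_ : Preorder ι) (_ : IsDirectedOrder ι) (_ : Nonempty ι) (e : ι → X),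
      IsApproxOrderUnit e ∧ IsApproxIdentity P e

variable (X) in
/-- `X` is an AM-algebra: some product makes it an AM-algebra with approximate unit. -/
def IsAMAlgebra : Prop :=
  ∃ Q : X →ₗ[ℝ] X →ₗ[ℝ] X, IsAMAlgebraProduct Q

variable (X) in
/-- The positive part `(B_X)_+` of the closed unit ball, with the order of `X`. -/
abbrev PosBall : Type u := {x : X // 0 ≤ x ∧ ‖x‖ ≤ 1}

variable (X) in
/-- The functionals on `X` that are lattice homomorphisms. -/
def latticeHoms : Set (StrongDual ℝ X) :=
  {φ | ∀ x y : X, φ (x ⊔ y) = φ x ⊔ φ y ∧ φ (x ⊓ y) = φ x ⊓ φ y}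

variable (X) in
/-- `K_X^*`: the nonzero lattice homomorphisms of norm at most one. -/
def KStar : Set (StrongDual ℝ X) := {φ | φ ∈ latticeHoms X ∧ ‖φ‖ ≤ 1 ∧ φ ≠ 0}

variable (X) in
/-- `K_X^1`: the lattice homomorphisms of norm one. -/
def KOne : Set (StrongDual ℝ X) := {φ | φ ∈ latticeHoms X ∧ ‖φ‖ = 1}

/-- `T`, with values in a space of real functions on `K`, is a lattice-algebra homomorphism for the
product `P` on `X` and the pointwise lattice operations and product of functions. -/
def IsLatticeAlgebraHom {K F : Type*} [FunLike F K ℝ] (P : X →ₗ[ℝ] X →ₗ[ℝ] X) (T : X → F) : Prop :=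
  ∀ (x y : X) (t : K), T (x ⊔ y) t = T x t ⊔ T y t ∧ T (x ⊓ y) t = T x t ⊓ T y t ∧
    T (P x y) t = T x t * T y t

variable [IsOrderedAddMonoid X] [HasSolidNorm X] [IsOrderedModule ℝ X]

theorem norm_apply_le_norm_abs {P : X →ₗ[ℝ] X →ₗ[ℝ] X} (hP : IsLatticeAlgebraProduct P) (x y : X) :
    ‖P x y‖ ≤ ‖P |x| |y|‖ := by
  have h1 : 0 ≤ P (|x| - x) (|y| + y) :=
    hP.pos _ _ (sub_nonneg.2 (le_abs_self x))
      (by simpa [add_comm] using neg_le_iff_add_nonneg.1 (neg_le_abs y))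
  have h2 : 0 ≤ P (|x| + x) (|y| - y) :=
    hP.pos _ _ (by simpa [add_comm] using neg_le_iff_add_nonneg.1 (neg_le_abs x))
      (sub_nonneg.2 (le_abs_self y))
  have h3 : 0 ≤ P (|x| - x) (|y| - y) :=
    hP.pos _ _ (sub_nonneg.2 (le_abs_self x)) (sub_nonneg.2 (le_abs_self y))
  have h4 : 0 ≤ P (|x| + x) (|y| + y) :=
    hP.pos _ _ (by simpa [add_comm] using neg_le_iff_add_nonneg.1 (neg_le_abs x))
      (by simpa [add_comm] using neg_le_iff_add_nonneg.1 (neg_le_abs y))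
  have h12 := add_nonneg h1 h2
  have h34 := add_nonneg h3 h4
  have key : ∀ z : X, 0 ≤ z + z → 0 ≤ z := fun z hz => by
    have h := smul_nonneg (by norm_num : (0 : ℝ) ≤ 1 / 2) hz
    rwa [← two_smul ℝ z, smul_smul, one_div, inv_mul_cancel₀ two_ne_zero, one_smul] at h
  refine norm_le_norm_of_abs_le_abs ?_
  refine le_trans ?_ (le_abs_self _)
  rw [abs_le']
  constructor
  · rw [← sub_nonneg]
    apply key
    convert h12 using 1
    simp only [map_sub, map_add, LinearMap.sub_apply, LinearMap.add_apply]
    abel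
  · rw [← sub_nonneg]
    apply key
    convert h34 using 1
    simp only [map_sub, map_add, LinearMap.sub_apply, LinearMap.add_apply]
    abel

variable [CompleteSpace X]

/-- Positive bilinear maps on a Banach lattice are bounded. -/
theorem exists_bound {P : X →ₗ[ℝ] X →ₗ[ℝ] X} (hP : IsLatticeAlgebraProduct P) :
    ∃ C : ℝ, ∀ x y : X, ‖P x y‖ ≤ C * ‖x‖ * ‖y‖ := by
  by_contra! hcon
  have H : ∀ n : ℕ, ∃ u v : X, 0 ≤ u ∧ 0 ≤ v ∧ ‖u‖ ≤ (1 / 2) ^ n ∧ ‖v‖ ≤ (1 / 2) ^ n ∧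
      (n : ℝ) ≤ ‖P u v‖ := by
    intro n
    obtain ⟨x, y, hxy⟩ := hcon (n * 4 ^ n)
    have hx : 0 < ‖x‖ := norm_pos_iff.2 fun h => by simp [h] at hxy
    have hy : 0 < ‖y‖ := norm_pos_iff.2 fun h => by simp [h] at hxy
    have ha : (0 : ℝ) ≤ (1 / 2) ^ n / ‖x‖ := by positivity
    have hb : (0 : ℝ) ≤ (1 / 2) ^ n / ‖y‖ := by positivity
    refine ⟨((1 / 2) ^ n / ‖x‖) • |x|, ((1 / 2) ^ n / ‖y‖) • |y|, smul_nonneg ha (abs_nonneg x),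
      smul_nonneg hb (abs_nonneg y), ?_, ?_, ?_⟩
    · rw [norm_smul, norm_abs_eq_norm, Real.norm_of_nonneg ha, div_mul_cancel₀ _ hx.ne']
    · rw [norm_smul, norm_abs_eq_norm, Real.norm_of_nonneg hb, div_mul_cancel₀ _ hy.ne']
    · have h := hxy.le.trans (norm_apply_le_norm_abs hP x y)
      rw [map_smul, map_smul, LinearMap.smul_apply, norm_smul, norm_smul, Real.norm_of_nonneg ha,
        Real.norm_of_nonneg hb]
      have e : (n : ℝ) = (1 / 2) ^ n / ‖y‖ * ((1 / 2) ^ n / ‖x‖ * (n * 4 ^ n * ‖x‖ * ‖y‖)) := by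
        have h4 : (4 : ℝ) ^ n = 2 ^ n * 2 ^ n := by rw [← mul_pow]; norm_num
        rw [h4, one_div, inv_pow]
        field_simp
      rw [e]
      gcongr
  choose u v hu hv hun hvn huv using H
  have hsu : Summable u := Summable.of_norm_bounded summable_geometric_two hun
  have hsv : Summable v := Summable.of_norm_bounded summable_geometric_two hvn
  have bound : ∀ n : ℕ, (n : ℝ) ≤ ‖P (∑' i, u i) (∑' i, v i)‖ := by
    intro n
    have h1 : u n ≤ ∑' i, u i := hsu.le_tsum n fun j _ => hu j
    have h2 : v n ≤ ∑' i, v i := hsv.le_tsum n fun j _ => hv j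
    have h0 : 0 ≤ P (u n) (v n) := hP.pos _ _ (hu n) (hv n)
    have h3 : P (u n) (v n) ≤ P (u n) (∑' i, v i) := by
      have := hP.pos _ _ (hu n) (sub_nonneg.2 h2)
      rwa [map_sub, sub_nonneg] at this
    have h4 : P (u n) (∑' i, v i) ≤ P (∑' i, u i) (∑' i, v i) := by
      have := hP.pos _ _ (sub_nonneg.2 h1) ((hv n).trans h2)
      rwa [map_sub, LinearMap.sub_apply, sub_nonneg] at this
    refine (huv n).trans (norm_le_norm_of_abs_le_abs ?_)
    rw [abs_of_nonneg h0, abs_of_nonneg (h0.trans (h3.trans h4))]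
    exact h3.trans h4
  obtain ⟨n, hn⟩ := exists_nat_gt ‖P (∑' i, u i) (∑' i, v i)‖
  exact absurd (bound n) (not_le.2 hn)

/-- The product of a vector lattice algebra on a Banach lattice, as a bounded bilinear map. -/
noncomputable def toBounded {P : X →ₗ[ℝ] X →ₗ[ℝ] X} (hP : IsLatticeAlgebraProduct P) :
    X →L[ℝ] X →L[ℝ] X :=
  P.mkContinuous₂ (exists_bound hP).choose (exists_bound hP).choose_spec

end BanachLattice

end AMAlg

set_option linter.unusedSectionVars false

/-! Every condition is compared with multiplicativity of the norm-one lattice homomorphisms. An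
approximate order unit makes the norm additive on the dual cone, so each extreme point `φ` of the
positive dual ball is an atom: only multiples of `φ` lie between `0` and `φ`. If positive elements
of the unit ball multiply below the identity (`IsSubunital`), then `φ (P a ·)` and `φ (P · a)` lie
in that interval for such `a`, hence `φ (P x y) = k * φ x * φ y`; an approximate identity on which
`φ` tends to one forces `k * φ y = φ y`. Disjoint elements have product zero, so `φ` is a lattice
homomorphism. By Krein–Milman such `φ` compute the norm (`exists_mem_KOne_abs_apply_eq`), so
multiplicativity on `KOne X` determines the product.

Conversely, multiplicativity represents `X`, by Stone–Weierstrass, as all continuous functions on a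
compact space vanishing at one point (`exists_representation`); this yields the closed ideal, the
closed subalgebra and `C₀(Ω)`. Any representation by functions gives back the approximate identity
`(B_X)_+`, through the elements `1 - (1 - a) ^ n` (`isApproxIdentity_posBall_of_representation`).

For the bidual, a weak* limit `E` of `(B_X)_+` is both an order unit and an identity of the first
Arens product. Extreme states of a space with order unit are multiplicative, so the bidual is a
`C(K)` (`exists_continuousMap`), which is commutative. -/

namespace AMAlg

/-! ### Weak* compactness and extreme points. -/

section WeakStar

variable {V : Type*} [NormedAddCommGroup V] [NormedSpace ℝ V]

theorem norm_le_one_of_apply_le {φ : StrongDual ℝ V} (h : ∀ x, φ x ≤ ‖x‖) : ‖φ‖ ≤ 1 := by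
  refine φ.opNorm_le_bound zero_le_one fun x => ?_
  rw [Real.norm_eq_abs, one_mul, abs_le']
  refine ⟨h x, ?_⟩
  simpa using h (-x)

theorem apply_le_norm {φ : StrongDual ℝ V} (h : ‖φ‖ ≤ 1) (x : V) : φ x ≤ ‖x‖ :=
  (le_abs_self _).trans ((φ.le_opNorm x).trans (mul_le_of_le_one_left (norm_nonneg x) h))

theorem isClosed_setOf_apply_le_norm : IsClosed {φ : WeakDual ℝ V | ∀ x, φ x ≤ ‖x‖} := by
  simp only [Set.ofPred_forall]
  exact isClosed_iInter fun x => isClosed_le (WeakDual.eval_continuous x) continuous_const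

theorem isCompact_setOf_apply_le_norm : IsCompact {φ : WeakDual ℝ V | ∀ x, φ x ≤ ‖x‖} := by
  refine (WeakDual.isCompact_closedBall (𝕜 := ℝ) (0 : StrongDual ℝ V) 1).of_isClosed_subset
    isClosed_setOf_apply_le_norm fun φ hφ => ?_
  simpa using norm_le_one_of_apply_le (φ := WeakDual.toStrongDual φ) hφ

instance : LocallyConvexSpace ℝ (WeakDual ℝ V) :=
  inferInstanceAs (LocallyConvexSpace ℝ (WeakBilin (topDualPairing ℝ V)))

/-- A compact set of functionals on which `φ ↦ φ x` is maximal at `φ₀` has an extreme point with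
the same value at `x`. -/
theorem exists_extremePoint_apply_eq {C : Set (WeakDual ℝ V)} (hC : IsCompact C)
    {φ₀ : WeakDual ℝ V} (h₀ : φ₀ ∈ C) (x : V) (hmax : ∀ φ ∈ C, φ x ≤ φ₀ x) :
    ∃ φ ∈ C.extremePoints ℝ, φ x = φ₀ x := by
  let l : StrongDual ℝ (WeakDual ℝ V) :=
    { toFun := fun φ => φ x
      map_add' := fun _ _ => rfl
      map_smul' := fun _ _ => rfl
      cont := WeakDual.eval_continuous x }
  -- The maximisers form a compact exposed face, and extreme points of a face are extreme in `C`.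
  have hexp : IsExposed ℝ C (l.toExposed C) := ContinuousLinearMap.toExposed.isExposed
  have hne : (l.toExposed C).Nonempty := ⟨φ₀, h₀, hmax⟩
  obtain ⟨φ, hφ⟩ := (hexp.isCompact hC).extremePoints_nonempty hne
  refine ⟨φ, hexp.isExtreme.extremePoints_subset_extremePoints hφ, ?_⟩
  have h := extremePoints_subset hφ
  exact le_antisymm (hmax φ h.1) (h.2 φ₀ h₀)

/-- Functionals on the weak* dual of a normed space are evaluations. -/
theorem exists_eval_eq (l : StrongDual ℝ (WeakDual ℝ V)) :
    ∃ x : V, ∀ φ : WeakDual ℝ V, l φ = φ x := by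
  obtain ⟨x, hx⟩ := LinearMap.dualEmbedding_surjective (topDualPairing ℝ V) l
  exact ⟨x, fun φ => by rw [← hx]; rfl⟩

end WeakStar

/-! ### Spaces with order unit and their multiplicative states. -/

section OrderUnit

variable {V : Type u} [NormedAddCommGroup V] [NormedSpace ℝ V] [Preorder V]
  [IsOrderedAddMonoid V] [PosSMulMono ℝ V] {e : V}

theorem IsOrderUnit.norm_le_iff (he : IsOrderUnit e) {c : ℝ} (hc : 0 < c) (x : V) :
    ‖x‖ ≤ c ↔ -(c • e) ≤ x ∧ x ≤ c • e := by
  have h1 : ‖c⁻¹ • x‖ ≤ 1 ↔ ‖x‖ ≤ c := by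
    rw [norm_smul, Real.norm_of_nonneg (by positivity), inv_mul_le_iff₀ hc, mul_one]
  have hx : x = c • c⁻¹ • x := by rw [smul_smul, mul_inv_cancel₀ hc.ne', one_smul]
  have hce : c⁻¹ • c • e = e := by rw [smul_smul, inv_mul_cancel₀ hc.ne', one_smul]
  rw [← h1, he]
  constructor
  · rintro ⟨h, h'⟩
    rw [hx, ← smul_neg]
    exact ⟨smul_le_smul_of_nonneg_left h hc.le, smul_le_smul_of_nonneg_left h' hc.le⟩
  · rintro ⟨h, h'⟩
    have h2 := smul_le_smul_of_nonneg_left h (inv_nonneg.2 hc.le)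
    have h3 := smul_le_smul_of_nonneg_left h' (inv_nonneg.2 hc.le)
    rw [smul_neg, hce] at h2
    rw [hce] at h3
    exact ⟨h2, h3⟩

theorem IsOrderUnit.nonneg (he : IsOrderUnit e) : 0 ≤ e := ((he 0).1 (by simp)).2

theorem IsOrderUnit.norm_le_one (he : IsOrderUnit e) : ‖e‖ ≤ 1 :=
  (he e).2 ⟨(neg_nonpos.2 he.nonneg).trans he.nonneg, le_rfl⟩

/-- Positivity is read off from the norm and `e` alone, so isometries that send order unit to order
unit respect the order. -/
theorem IsOrderUnit.nonneg_iff (he : IsOrderUnit e) {c : ℝ} (hc : 0 < c) {x : V} (hx : ‖x‖ ≤ c) :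
    0 ≤ x ↔ ‖c • e - x‖ ≤ c := by
  rw [he.norm_le_iff hc]
  constructor
  · intro h
    refine ⟨?_, sub_le_self _ h⟩
    have := sub_nonneg.2 ((he.norm_le_iff hc x).1 hx).2
    exact (neg_nonpos.2 (smul_nonneg hc.le he.nonneg)).trans this
  · rintro ⟨-, h⟩
    simpa using h

/-- Functionals of norm at most one with value one at the order unit are positive. -/
theorem IsOrderUnit.apply_nonneg (he : IsOrderUnit e) {ω : StrongDual ℝ V}
    (h1 : ∀ x, ω x ≤ ‖x‖) (h2 : ω e = 1) {x : V} (hx : 0 ≤ x) : 0 ≤ ω x := by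
  have hc : 0 < ‖x‖ + 1 := by positivity
  have h := (h1 _).trans ((he.nonneg_iff hc (by linarith)).1 hx)
  simp only [map_sub, map_smul, h2, smul_eq_mul, mul_one] at h
  linarith

/-- A positive functional is determined in size by its value at the order unit. -/
theorem IsOrderUnit.apply_le (he : IsOrderUnit e) {ψ : V →ₗ[ℝ] ℝ}
    (hψ : ∀ x, 0 ≤ x → 0 ≤ ψ x) (x : V) : ψ x ≤ ψ e * ‖x‖ := by
  have key : ∀ c, 0 < c → ‖x‖ ≤ c → ψ x ≤ c * ψ e := fun c hc hxc => by
    have := hψ _ (sub_nonneg.2 ((he.norm_le_iff hc x).1 hxc).2)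
    simpa using this
  rcases eq_or_ne x 0 with rfl | hx
  · simp
  · rw [mul_comm]
    exact key _ (norm_pos_iff.2 hx) le_rfl

/-- The states of a space with order unit. -/
def stateSpace (e : V) : Set (WeakDual ℝ V) := {ω | (∀ x, ω x ≤ ‖x‖) ∧ ω e = 1}

theorem isCompact_stateSpace (e : V) : IsCompact (stateSpace e) :=
  isCompact_setOf_apply_le_norm.inter_right
    (isClosed_eq (WeakDual.eval_continuous e) continuous_const)

/-- With `m = ‖x‖`, one of `m • e ± x` has norm `2 * m`, since otherwise `x` would lie in a smaller
multiple of `[-e, e]`. A functional norming that element is forced to be a state with value `m` at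
`± x`. -/
theorem IsOrderUnit.exists_extreme_abs_apply_eq (he : IsOrderUnit e) {x : V} (hx : x ≠ 0) :
    ∃ ω ∈ (stateSpace e).extremePoints ℝ, |ω x| = ‖x‖ := by
  set m := ‖x‖ with hm
  have hm0 : 0 < m := norm_pos_iff.2 hx
  have key : ∀ y : V, ‖y‖ = m → 2 * m ≤ ‖m • e + y‖ →
      ∃ ω ∈ (stateSpace e).extremePoints ℝ, ω y = m := by
    intro y hy h
    have hne : m • e + y ≠ 0 := fun h0 => by rw [h0, norm_zero] at h; linarith
    obtain ⟨f, hf1, hf⟩ := exists_dual_vector ℝ (m • e + y) (norm_ne_zero_iff.2 hne)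
    have hf1' : ∀ z, f z ≤ ‖z‖ := apply_le_norm hf1.le
    simp only [map_add, map_smul, smul_eq_mul, RCLike.ofReal_real_eq_id, id] at hf
    have h1 := (hf1' e).trans he.norm_le_one
    have h2 := (hf1' y).trans hy.le
    have h3 : f e = 1 := by nlinarith
    have h4 : f y = m := by nlinarith
    obtain ⟨ω, hω, hωy⟩ := exists_extremePoint_apply_eq (isCompact_stateSpace e)
      (φ₀ := StrongDual.toWeakDual f) ⟨hf1', h3⟩ y
      (fun φ hφ => ((hφ.1 y).trans hy.le).trans h4.ge)
    exact ⟨ω, hω, hωy.trans h4⟩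
  by_cases h : 2 * m ≤ ‖m • e + x‖
  · obtain ⟨ω, hω, h⟩ := key x rfl h
    exact ⟨ω, hω, by rw [h, abs_of_pos hm0]⟩
  by_cases h' : 2 * m ≤ ‖m • e + -x‖
  · obtain ⟨ω, hω, h⟩ := key (-x) (norm_neg x) h'
    refine ⟨ω, hω, ?_⟩
    rw [← abs_neg, ← map_neg, h, abs_of_pos hm0]
  exfalso
  rw [not_le] at h h'
  -- The bound `3 / 2 * m` only keeps `c - m` positive, as `norm_le_iff` requires.
  set c := max (max ‖m • e + x‖ ‖m • e + -x‖) (3 / 2 * m) with hcdef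
  have hc2 : c < 2 * m := max_lt (max_lt h h') (by linarith)
  have hc1 : 3 / 2 * m ≤ c := le_max_right _ _
  have h1 := ((he.norm_le_iff (by linarith) _).1
    ((le_max_left _ _).trans (le_max_left _ _) : ‖m • e + x‖ ≤ c)).2
  have h2 := ((he.norm_le_iff (by linarith) _).1
    ((le_max_right _ _).trans (le_max_left _ _) : ‖m • e + -x‖ ≤ c)).2
  have h3 : ‖x‖ ≤ c - m := by
    rw [he.norm_le_iff (by linarith), sub_smul]
    constructor
    · rw [neg_le]
      exact le_sub_iff_add_le'.2 h2
    · exact le_sub_iff_add_le'.2 h1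
  linarith

/-- The extreme states are multiplicative. -/
theorem IsOrderUnit.extreme_apply_mul (he : IsOrderUnit e) {A : V →ₗ[ℝ] V →ₗ[ℝ] V}
    (hpos : ∀ x y, 0 ≤ x → 0 ≤ y → 0 ≤ A x y) (hid : IsAlgIdentity A e) {ω : WeakDual ℝ V}
    (hω : ω ∈ (stateSpace e).extremePoints ℝ) (x y : V) : ω (A x y) = ω x * ω y := by
  have hst : (∀ x, ω x ≤ ‖x‖) ∧ ω e = 1 := (extremePoints_subset hω : ω ∈ stateSpace e)
  have hωpos : ∀ z, 0 ≤ z → 0 ≤ ω z := fun z hz =>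
    he.apply_nonneg (ω := WeakDual.toStrongDual ω) hst.1 hst.2 hz
  have hzero : ∀ ψ : V →ₗ[ℝ] ℝ, (∀ z, 0 ≤ z → 0 ≤ ψ z) → ψ e = 0 → ∀ z, ψ z = 0 := by
    intro ψ hψ h0 z
    have h1 := he.apply_le hψ z
    have h2 := he.apply_le hψ (-z)
    rw [h0, zero_mul] at h1 h2
    rw [map_neg] at h2
    linarith
  have hstate : ∀ ψ : V →ₗ[ℝ] ℝ, (∀ z, 0 ≤ z → 0 ≤ ψ z) → 0 < ψ e →
      ∃ χ ∈ stateSpace e, ∀ z, χ z = (ψ e)⁻¹ * ψ z := by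
    intro ψ hψ h0
    have hle : ∀ z, ((ψ e)⁻¹ • ψ) z ≤ ‖z‖ := fun z => by
      have := he.apply_le hψ z
      rw [LinearMap.smul_apply, smul_eq_mul, inv_mul_le_iff₀ h0]
      exact this
    refine ⟨StrongDual.toWeakDual (LinearMap.mkContinuous ((ψ e)⁻¹ • ψ) 1 fun z => ?_),
      ⟨hle, inv_mul_cancel₀ h0.ne'⟩, fun z => rfl⟩
    rw [Real.norm_eq_abs, one_mul, abs_le']
    exact ⟨hle z, by simpa using hle (-z)⟩
  -- For `0 ≤ x ≤ e`, the state `ω` is the sum of the positive functionals `ω (A x ·)` and `ω - ω (A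
  -- x ·)`, with values `ω x` and `1 - ω x` at `e`. Normalised, they exhibit `ω` as a convex
  -- combination, so extremality applies; if a weight is zero, that functional vanishes.
  have key : ∀ x, 0 ≤ x → x ≤ e → ∀ y, ω (A x y) = ω x * ω y := by
    intro x hx hxe y
    let ωl : V →ₗ[ℝ] ℝ := (WeakDual.toStrongDual ω : V →L[ℝ] ℝ)
    let ψ : V →ₗ[ℝ] ℝ := ωl.comp (A x)
    have hψ_apply : ∀ z, ψ z = ω (A x z) := fun z => rfl
    have hχ_apply : ∀ z, (ωl - ψ) z = ω z - ω (A x z) := fun z => rfl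
    have hψ : ∀ z, 0 ≤ z → 0 ≤ ψ z := fun z hz => hωpos _ (hpos _ _ hx hz)
    have hχ : ∀ z, 0 ≤ z → 0 ≤ (ωl - ψ) z := fun z hz => by
      have := hωpos _ (hpos _ _ (sub_nonneg.2 hxe) hz)
      rw [hχ_apply]
      simpa [(hid z).1] using this
    have hψe : ψ e = ω x := by rw [hψ_apply, (hid x).2]
    have hχe : (ωl - ψ) e = 1 - ω x := by rw [hχ_apply, (hid x).2, hst.2]
    have hx0 : 0 ≤ ω x := hωpos x hx
    have hx1 : 0 ≤ 1 - ω x := hχe ▸ hχ e he.nonneg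
    rcases hx0.eq_or_lt with h0 | h0
    · rw [← h0, zero_mul]
      exact hzero ψ hψ (hψe.trans h0.symm) y
    rcases hx1.eq_or_lt with h1 | h1
    · have := hzero _ hχ (hχe.trans h1.symm) y
      rw [hχ_apply] at this
      have h2 : ω x = 1 := by linarith
      rw [h2]
      linarith
    obtain ⟨ψ', hψ', hψ'a⟩ := hstate ψ hψ (by rwa [hψe])
    obtain ⟨χ', hχ', hχ'a⟩ := hstate _ hχ (by rwa [hχe])
    have hseg : ω ∈ openSegment ℝ ψ' χ' := by
      refine ⟨ω x, 1 - ω x, h0, h1, by ring, ?_⟩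
      refine DFunLike.ext _ _ fun z => ?_
      change ω x * ψ' z + (1 - ω x) * χ' z = ω z
      rw [hψ'a, hχ'a, hψe, hχe, hχ_apply, hψ_apply, mul_inv_cancel_left₀ h0.ne',
        mul_inv_cancel_left₀ h1.ne']
      ring
    have heq : ψ' = ω := hω.2 hψ' hχ' hseg
    have := hψ'a y
    rw [heq, hψe, hψ_apply] at this
    rw [this, mul_inv_cancel_left₀ h0.ne']
  -- A general `x` is moved into `[0, e]` by `x ↦ (c • e + x) / (2 * c)`; the identity is affine in
  -- `x` and holds at `e`.
  have hc : 0 < ‖x‖ + 1 := by positivity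
  set c := ‖x‖ + 1 with hcdef
  obtain ⟨h1, h2⟩ := (he.norm_le_iff hc x).1 (by linarith)
  have h3 : 0 ≤ (2 * c)⁻¹ • (c • e + x) :=
    smul_nonneg (by positivity) (by simpa [add_comm] using neg_le_iff_add_nonneg.1 h1)
  have h4 : (2 * c)⁻¹ • (c • e + x) ≤ e := by
    have : (2 * c)⁻¹ • (c • e + x) ≤ (2 * c)⁻¹ • ((2 * c) • e) := by
      refine smul_le_smul_of_nonneg_left ?_ (by positivity)
      rw [two_mul, add_smul c c]
      exact add_le_add le_rfl h2
    rwa [smul_smul, inv_mul_cancel₀ (by positivity), one_smul] at this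
  have h5 := key _ h3 h4 y
  simp only [map_smul, map_add, LinearMap.smul_apply, LinearMap.add_apply, smul_eq_mul, (hid y).1,
    hst.2] at h5
  rw [mul_assoc] at h5
  have h6 := mul_left_cancel₀ (inv_ne_zero (by positivity)) h5
  linarith

/-- A complete space with order unit and a positive bilinear map for which the order unit is the
identity is a space of continuous functions. -/
theorem IsOrderUnit.exists_continuousMap [CompleteSpace V] (he : IsOrderUnit e)
    {A : V →ₗ[ℝ] V →ₗ[ℝ] V} (hpos : ∀ x y, 0 ≤ x → 0 ≤ y → 0 ≤ A x y) (hid : IsAlgIdentity A e) :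
    ∃ (K : Type u) (_ : TopologicalSpace K) (_ : CompactSpace K) (_ : T2Space K)
      (J : V ≃ₗᵢ[ℝ] C(K, ℝ)), (∀ x y, J x ≤ J y ↔ x ≤ y) ∧ (∀ x y, J (A x y) = J x * J y) ∧
        J e = 1 := by
  let C : Set (WeakDual ℝ V) := {ω | ω ∈ stateSpace e ∧ ∀ x y, ω (A x y) = ω x * ω y}
  have hC : IsCompact C := by
    refine (isCompact_stateSpace e).inter_right (t := {ω | ∀ x y, ω (A x y) = ω x * ω y}) ?_
    simp only [Set.ofPred_forall]
    exact isClosed_iInter fun x => isClosed_iInter fun y =>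
      isClosed_eq (WeakDual.eval_continuous _)
        ((WeakDual.eval_continuous x).mul (WeakDual.eval_continuous y))
  have : CompactSpace C := isCompact_iff_compactSpace.1 hC
  let Tl : V →ₗ[ℝ] C(C, ℝ) :=
    { toFun := fun x => ⟨fun ω => ω.1 x, (WeakDual.eval_continuous x).comp continuous_subtype_val⟩
      map_add' := fun x y => by ext ω; exact map_add ω.1 x y
      map_smul' := fun c x => by ext ω; exact map_smul ω.1 c x }
  have hT : ∀ x (ω : C), Tl x ω = ω.1 x := fun _ _ => rfl
  have habs : ∀ x (ω : C), |ω.1 x| ≤ ‖x‖ := fun x ω =>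
    abs_le'.2 ⟨ω.2.1.1 x, by simpa using ω.2.1.1 (-x)⟩
  have hnorm : ∀ x, ‖Tl x‖ = ‖x‖ := by
    intro x
    refine le_antisymm ((ContinuousMap.norm_le _ (norm_nonneg x)).2 fun ω => habs x ω) ?_
    rcases eq_or_ne x 0 with rfl | hx
    · simp
    obtain ⟨ω, hω, h⟩ := he.exists_extreme_abs_apply_eq hx
    rw [← h]
    exact (Tl x).norm_coe_le_norm
      ⟨ω, extremePoints_subset hω, fun x y => he.extreme_apply_mul hpos hid hω x y⟩
  let T : V →ₗᵢ[ℝ] C(C, ℝ) := ⟨Tl, hnorm⟩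
  have hTe : T e = 1 := by ext ω; exact ω.2.1.2
  have hTmul : ∀ x y, T (A x y) = T x * T y := fun x y => by ext ω; exact ω.2.2 x y
  let S : Subalgebra ℝ C(C, ℝ) :=
    { carrier := Set.range T
      mul_mem' := by
        rintro _ _ ⟨x, rfl⟩ ⟨y, rfl⟩
        exact ⟨A x y, hTmul x y⟩
      add_mem' := by
        rintro _ _ ⟨x, rfl⟩ ⟨y, rfl⟩
        exact ⟨x + y, map_add T x y⟩
      algebraMap_mem' := fun r => ⟨r • e, by
        rw [map_smul, hTe, Algebra.algebraMap_eq_smul_one]⟩ }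
  have hsep : S.SeparatesPoints := by
    intro ω χ hne
    have : ∃ x, ω.1 x ≠ χ.1 x := by
      by_contra! h
      exact hne (Subtype.ext (DFunLike.ext _ _ h))
    obtain ⟨x, hx⟩ := this
    exact ⟨T x, ⟨T x, ⟨x, rfl⟩, rfl⟩, hx⟩
  have hclosed : IsClosed (S : Set C(C, ℝ)) := T.isometry.isClosedEmbedding.isClosed_range
  have htop := ContinuousMap.subalgebra_topologicalClosure_eq_top_of_separatesPoints S hsep
  have hsurj : Function.Surjective T := fun f => by
    have hf : f ∈ S.topologicalClosure := htop ▸ Algebra.mem_top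
    rw [← SetLike.mem_coe, Subalgebra.topologicalClosure_coe, hclosed.closure_eq] at hf
    exact hf
  refine ⟨C, inferInstance, inferInstance, inferInstance, LinearIsometryEquiv.ofSurjective T hsurj,
    ?_, hTmul, hTe⟩
  -- `T` is isometric with `T e = 1`, so the norm criterion for positivity transfers.
  have h0 : ∀ x, 0 ≤ T x ↔ 0 ≤ x := by
    intro x
    have hc : 0 < ‖x‖ + 1 := by positivity
    have hle : ‖x‖ ≤ ‖x‖ + 1 := by linarith
    rw [he.nonneg_iff hc hle]
    constructor
    · intro h
      rw [← T.norm_map, ContinuousMap.norm_le _ hc.le]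
      intro ω
      have h1 : 0 ≤ ω.1 x := h ω
      have h2 := (abs_le.1 (habs x ω)).2
      change |ω.1 ((‖x‖ + 1) • e - x)| ≤ _
      rw [map_sub, map_smul, ω.2.1.2, smul_eq_mul, mul_one, abs_le]
      constructor <;> linarith
    · intro h ω
      change 0 ≤ ω.1 x
      have := (habs _ ω).trans h
      rw [map_sub, map_smul, ω.2.1.2, smul_eq_mul, mul_one, abs_le] at this
      linarith
  intro x y
  rw [LinearIsometryEquiv.coe_ofSurjective, ← sub_nonneg, ← map_sub, h0, sub_nonneg]

end OrderUnit

/-! ### Positive functionals, lattice homomorphisms and subunital products. -/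

section BanachLattice

variable {X : Type u} [NormedAddCommGroup X] [NormedSpace ℝ X] [Lattice X]
  [IsOrderedAddMonoid X] [IsOrderedModule ℝ X] [HasSolidNorm X]

theorem norm_le_norm_of_nonneg_of_le {x y : X} (hx : 0 ≤ x) (h : x ≤ y) : ‖x‖ ≤ ‖y‖ :=
  norm_le_norm_of_abs_le_abs (by rwa [abs_of_nonneg hx, abs_of_nonneg (hx.trans h)])

theorem norm_posPart_le (x : X) : ‖x⁺‖ ≤ ‖x‖ :=
  norm_abs_eq_norm x ▸ norm_le_norm_of_nonneg_of_le (posPart_nonneg x)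
    (sup_le (le_abs_self x) (abs_nonneg x))

theorem norm_posPart_add_le (x y : X) : ‖(x + y)⁺‖ ≤ ‖x⁺‖ + ‖y⁺‖ :=
  (norm_le_norm_of_nonneg_of_le (posPart_nonneg _) (sup_le (add_le_add (le_posPart x)
    (le_posPart y)) (add_nonneg (posPart_nonneg x) (posPart_nonneg y)))).trans (norm_add_le _ _)

theorem posPart_smul_of_nonneg {c : ℝ} (hc : 0 < c) (x : X) : (c • x)⁺ = c • x⁺ := by
  refine le_antisymm (sup_le (smul_le_smul_of_nonneg_left (le_posPart x) hc.le)
    (smul_nonneg hc.le (posPart_nonneg x))) ?_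
  rw [← le_inv_smul_iff_of_pos hc]
  refine sup_le ?_ (smul_nonneg (inv_nonneg.2 hc.le) (posPart_nonneg _))
  rw [le_inv_smul_iff_of_pos hc]
  exact le_posPart _

/-- Positive functionals of norm at most one compute the norm of the positive part. -/
theorem exists_nonneg_apply_eq_norm_posPart (x : X) :
    ∃ φ : StrongDual ℝ X, 0 ≤ φ ∧ ‖φ‖ ≤ 1 ∧ φ x = ‖x⁺‖ := by
  rcases eq_or_ne x 0 with rfl | hx
  · exact ⟨0, le_rfl, by simp, by simp⟩
  have hsmul : ∀ c : ℝ, 0 < c → ∀ y : X, ‖(c • y)⁺‖ = c * ‖y⁺‖ := fun c hc y => by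
    rw [posPart_smul_of_nonneg hc, norm_smul, Real.norm_of_nonneg hc.le]
  -- Hahn–Banach with the sublinear map `y ↦ ‖y⁺‖`: the bound makes the extension contractive, and
  -- positive because `(-y)⁺ = 0` for `y ≥ 0`.
  obtain ⟨g, hg, hle⟩ := exists_extension_of_le_sublinear
    (LinearPMap.mkSpanSingleton x ‖x⁺‖ hx) (fun y => ‖y⁺‖) hsmul norm_posPart_add_le (by
      rintro ⟨z, hz⟩
      obtain ⟨t, rfl⟩ := Submodule.mem_span_singleton.1 hz
      rw [LinearPMap.mkSpanSingleton'_apply]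
      change t * ‖x⁺‖ ≤ ‖(t • x)⁺‖
      rcases le_or_gt t 0 with ht | ht
      · exact (mul_nonpos_of_nonpos_of_nonneg ht (norm_nonneg _)).trans (norm_nonneg _)
      · rw [hsmul t ht])
  have hgpos : ∀ y, 0 ≤ y → 0 ≤ g y := fun y hy => by
    have := hle (-y)
    rw [map_neg, posPart_eq_zero.2 (neg_nonpos.2 hy), norm_zero] at this
    linarith
  have hgle : ∀ y, g y ≤ ‖y‖ := fun y => (hle y).trans (norm_posPart_le y)
  let φ : StrongDual ℝ X := g.mkContinuous 1 fun y => by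
    rw [Real.norm_eq_abs, one_mul, abs_le']
    exact ⟨hgle y, by simpa using hgle (-y)⟩
  refine ⟨φ, hgpos, norm_le_one_of_apply_le hgle, ?_⟩
  have := hg ⟨x, Submodule.mem_span_singleton_self x⟩
  change g x = _
  rw [this]
  exact LinearPMap.mkSpanSingleton'_apply_self _ _ _ _

theorem nonneg_of_forall_apply_nonneg {x : X} (h : ∀ φ : StrongDual ℝ X, 0 ≤ φ → 0 ≤ φ x) :
    0 ≤ x := by
  obtain ⟨φ, hφ, -, hx⟩ := exists_nonneg_apply_eq_norm_posPart (-x)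
  have := h φ hφ
  rw [map_neg] at hx
  have h0 : ‖(-x)⁺‖ = 0 := le_antisymm (by linarith) (norm_nonneg _)
  exact neg_nonpos.1 (posPart_eq_zero.1 (norm_eq_zero.1 h0))

theorem le_of_forall_apply_le {x y : X} (h : ∀ φ : StrongDual ℝ X, 0 ≤ φ → φ x ≤ φ y) : x ≤ y :=
  sub_nonneg.1 (nonneg_of_forall_apply_nonneg fun φ hφ => by
    rw [map_sub, sub_nonneg]
    exact h φ hφ)

theorem apply_mono {φ : StrongDual ℝ X} (hφ : 0 ≤ φ) {x y : X} (h : x ≤ y) : φ x ≤ φ y := by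
  have : 0 ≤ φ (y - x) := hφ _ (sub_nonneg.2 h)
  rwa [map_sub, sub_nonneg] at this

theorem abs_apply_le {φ : StrongDual ℝ X} (hφ : 0 ≤ φ) (x : X) : |φ x| ≤ φ |x| :=
  abs_le'.2 ⟨apply_mono hφ (le_abs_self x), map_neg φ x ▸ apply_mono hφ (neg_le_abs x)⟩

section LatticeHoms

variable {φ : StrongDual ℝ X}

theorem nonneg_of_mem_latticeHoms (hφ : φ ∈ latticeHoms X) : 0 ≤ φ := fun x hx => by
  have := (hφ x 0).1
  rw [sup_eq_left.2 hx, map_zero] at this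
  change 0 ≤ φ x
  rw [this]
  exact le_sup_right

theorem apply_abs_of_mem_latticeHoms (hφ : φ ∈ latticeHoms X) (x : X) : φ |x| = |φ x| := by
  have := (hφ x (-x)).1
  rwa [map_neg] at this

/-- One of `φ x⁺`, `φ x⁻` vanishes, so `φ` commutes with positive parts, which express `⊔` and `⊓`.
-/
theorem mem_latticeHoms_of_mul_eq_zero (hφ : 0 ≤ φ) (h : ∀ x : X, φ x⁺ * φ x⁻ = 0) :
    φ ∈ latticeHoms X := by
  have key : ∀ z : X, φ z⁺ = (φ z)⁺ := fun z => by
    have h1 : 0 ≤ φ z⁺ := hφ _ (posPart_nonneg z)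
    have h2 : 0 ≤ φ z⁻ := hφ _ (negPart_nonneg z)
    have h3 : φ z = φ z⁺ - φ z⁻ := by rw [← map_sub, posPart_sub_negPart]
    rcases mul_eq_zero.1 (h z) with h0 | h0
    · rw [h0, posPart_eq_zero.2]
      linarith
    · rw [h0, sub_zero] at h3
      rw [h3, posPart_of_nonneg h1]
  intro x y
  rw [sup_eq_add_posPart_sub, sup_eq_add_posPart_sub, inf_eq_sub_posPart_sub,
    inf_eq_sub_posPart_sub, map_add, map_sub, key, map_sub]
  exact ⟨rfl, rfl⟩

/-- Positive functionals below a lattice homomorphism are multiples of it. -/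
theorem exists_eq_mul_of_le_latticeHom (hφ : φ ∈ latticeHoms X) {ψ : StrongDual ℝ X}
    (hψ : 0 ≤ ψ) (h : ψ ≤ φ) : ∃ c : ℝ, ∀ x, ψ x = c * φ x := by
  -- `|ψ x| ≤ ψ |x| ≤ φ |x| = |φ x|`; functionals with nested kernels are proportional.
  have hker : ∀ x, φ x = 0 → ψ x = 0 := fun x hx => by
    have h1 := (abs_apply_le hψ x).trans (h _ (abs_nonneg x))
    rw [apply_abs_of_mem_latticeHoms hφ, hx, abs_zero] at h1
    exact abs_nonpos_iff.1 h1
  by_cases h0 : ∀ x, φ x = 0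
  · exact ⟨0, fun x => by rw [hker x (h0 x), zero_mul]⟩
  push Not at h0
  obtain ⟨z, hz⟩ := h0
  refine ⟨ψ z / φ z, fun x => ?_⟩
  have := hker (φ z • x - φ x • z) (by simp [mul_comm])
  rw [map_sub, map_smul, map_smul, smul_eq_mul, smul_eq_mul] at this
  field_simp
  linarith

end LatticeHoms

/-- Multiplication by positive elements of the unit ball is dominated by the identity. -/
def IsSubunital (P : X →ₗ[ℝ] X →ₗ[ℝ] X) : Prop :=
  ∀ a x : X, 0 ≤ a → ‖a‖ ≤ 1 → 0 ≤ x → P a x ≤ x ∧ P x a ≤ x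

variable {P : X →ₗ[ℝ] X →ₗ[ℝ] X}

theorem eq_zero_of_forall_nonneg {V : Type*} [AddCommGroup V] [Module ℝ V] {f : X →ₗ[ℝ] V}
    (h : ∀ x, 0 ≤ x → f x = 0) (x : X) : f x = 0 := by
  rw [← posPart_sub_negPart x, map_sub, h _ (posPart_nonneg x), h _ (negPart_nonneg x), sub_zero]

/-- Elements of the positive cone are multiples of positive elements of the unit ball. -/
theorem exists_smul_eq_of_nonneg {x : X} (hx : 0 ≤ x) :
    ∃ (c : ℝ) (a : X), 0 < c ∧ 0 ≤ a ∧ ‖a‖ ≤ 1 ∧ x = c • a := by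
  have hc : 0 < ‖x‖ + 1 := by positivity
  refine ⟨‖x‖ + 1, (‖x‖ + 1)⁻¹ • x, hc, smul_nonneg (inv_nonneg.2 hc.le) hx, ?_, ?_⟩
  · rw [norm_smul, Real.norm_of_nonneg (inv_nonneg.2 hc.le), inv_mul_le_iff₀ hc]
    linarith
  · rw [smul_smul, mul_inv_cancel₀ hc.ne', one_smul]

/-- After scaling into the unit ball the product lies below both factors, hence a positive multiple
of it lies below `x ⊓ y = 0`. -/
theorem IsSubunital.apply_eq_zero (hP : IsLatticeAlgebraProduct P) (hs : IsSubunital P) {x y : X}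
    (hx : 0 ≤ x) (hy : 0 ≤ y) (hxy : x ⊓ y = 0) : P x y = 0 := by
  obtain ⟨c, a, hc, ha, ha1, rfl⟩ := exists_smul_eq_of_nonneg hx
  obtain ⟨d, b, hd, hb, hb1, rfl⟩ := exists_smul_eq_of_nonneg hy
  have h0 : P a b = 0 := by
    have h1 : (min c d) • P a b ≤ c • a ⊓ d • b := by
      refine le_inf ?_ ?_
      · calc min c d • P a b ≤ min c d • a :=
              smul_le_smul_of_nonneg_left (hs b a hb hb1 ha).2 (by positivity)
          _ ≤ c • a := smul_le_smul_of_nonneg_right (min_le_left _ _) ha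
      · calc min c d • P a b ≤ min c d • b :=
              smul_le_smul_of_nonneg_left (hs a b ha ha1 hb).1 (by positivity)
          _ ≤ d • b := smul_le_smul_of_nonneg_right (min_le_right _ _) hb
    rw [hxy] at h1
    have h2 := le_antisymm h1 (smul_nonneg (by positivity) (hP.pos a b ha hb))
    exact (smul_eq_zero.1 h2).resolve_left (by positivity)
  simp [h0]

variable [CompleteSpace X]

theorem toBounded_apply (hP : IsLatticeAlgebraProduct P) (x y : X) : toBounded hP x y = P x y :=
  rfl

/-- If only multiples of `φ` lie between `0` and `φ`, then `φ ∘ P` is a multiple of `φ ⊗ φ`. -/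
theorem IsSubunital.exists_apply_eq (hP : IsLatticeAlgebraProduct P) (hs : IsSubunital P)
    {φ : StrongDual ℝ X} (hφ : 0 ≤ φ)
    (hatom : ∀ ψ : StrongDual ℝ X, 0 ≤ ψ → ψ ≤ φ → ∃ c : ℝ, ∀ x, ψ x = c * φ x) :
    ∃ k : ℝ, ∀ x y, φ (P x y) = k * φ x * φ y := by
  have hl : ∀ a, 0 ≤ a → ∃ c : ℝ, ∀ x, φ (P a x) = c * φ x := by
    intro a ha
    obtain ⟨r, a, -, ha0, ha1, rfl⟩ := exists_smul_eq_of_nonneg ha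
    obtain ⟨c, hc⟩ := hatom (φ.comp (toBounded hP a)) (fun x hx => hφ _ (hP.pos _ _ ha0 hx))
      (fun x hx => apply_mono hφ (hs a x ha0 ha1 hx).1)
    refine ⟨r * c, fun x => ?_⟩
    have : φ (P a x) = c * φ x := hc x
    rw [map_smul, LinearMap.smul_apply, map_smul, this, smul_eq_mul, mul_assoc]
  have hl' : ∀ a, ∃ c : ℝ, ∀ x, φ (P a x) = c * φ x := fun a => by
    obtain ⟨c, hc⟩ := hl _ (posPart_nonneg a)
    obtain ⟨d, hd⟩ := hl _ (negPart_nonneg a)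
    refine ⟨c - d, fun x => ?_⟩
    conv_lhs => rw [← posPart_sub_negPart a]
    rw [map_sub, LinearMap.sub_apply, map_sub, hc, hd, sub_mul]
  have hr : ∀ a, 0 ≤ a → ∃ c : ℝ, ∀ x, φ (P x a) = c * φ x := by
    intro a ha
    obtain ⟨r, a, -, ha0, ha1, rfl⟩ := exists_smul_eq_of_nonneg ha
    obtain ⟨c, hc⟩ := hatom (φ.comp ((toBounded hP).flip a)) (fun x hx => hφ _ (hP.pos _ _ hx ha0))
      (fun x hx => apply_mono hφ (hs a x ha0 ha1 hx).2)
    refine ⟨r * c, fun x => ?_⟩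
    have : φ (P x a) = c * φ x := hc x
    rw [map_smul, map_smul, this, smul_eq_mul, mul_assoc]
  by_cases h0 : ∀ x, 0 ≤ x → φ x = 0
  · have h0' : ∀ x, φ x = 0 := eq_zero_of_forall_nonneg (f := (φ : X →ₗ[ℝ] ℝ)) h0
    exact ⟨0, fun x y => by simp [h0']⟩
  push Not at h0
  obtain ⟨z, hz, hz0⟩ := h0
  obtain ⟨d, hd⟩ := hr z hz
  refine ⟨d / φ z, fun x y => ?_⟩
  obtain ⟨c, hc⟩ := hl' x
  -- Both sides equal `φ (P x z)`, so the coefficient `c` of left multiplication by `x` is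
  -- proportional to `φ x`.
  have h1 : c * φ z = d * φ x := (hc z).symm.trans (hd x)
  rw [hc]
  field_simp
  linear_combination φ y * h1

/-- Lattice homomorphisms of norm one are multiplicative for a subunital product with an
approximate identity on which they tend to one. -/
theorem IsSubunital.apply_mul_of_tendsto (hP : IsLatticeAlgebraProduct P) (hs : IsSubunital P)
    {φ : StrongDual ℝ X} (hφ : 0 ≤ φ)
    (hatom : ∀ ψ : StrongDual ℝ X, 0 ≤ ψ → ψ ≤ φ → ∃ c : ℝ, ∀ x, ψ x = c * φ x)
    {ι : Type*} {l : Filter ι} [l.NeBot] {e : ι → X}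
    (he : ∀ x, Tendsto (fun i => P (e i) x) l (𝓝 x)) (hφe : Tendsto (fun i => φ (e i)) l (𝓝 1))
    (x y : X) : φ (P x y) = φ x * φ y := by
  obtain ⟨k, hk⟩ := hs.exists_apply_eq hP hφ hatom
  have h1 : Tendsto (fun i => k * φ (e i) * φ y) l (𝓝 (φ y)) := by
    simpa only [Function.comp_def, hk] using (φ.continuous.tendsto y).comp (he y)
  have h2 := tendsto_nhds_unique h1 ((hφe.const_mul k).mul_const (φ y))
  calc φ (P x y) = φ x * (k * 1 * φ y) := by rw [hk]; ring
    _ = φ x * φ y := by rw [← h2]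

end BanachLattice

/-! ### Norm-one lattice homomorphisms and the approximate identity `(B_X)_+`. -/

section AMAlgebra

variable {X : Type u} [NormedAddCommGroup X] [NormedSpace ℝ X] [Lattice X]
  [IsOrderedAddMonoid X] [IsOrderedModule ℝ X] [HasSolidNorm X]

/-- On positive functionals the norm is a limit of evaluations, which are additive. This is what
turns extreme points into atoms. -/
theorem IsApproxOrderUnit.norm_add {ι : Type*} [Preorder ι] [IsDirectedOrder ι] [Nonempty ι]
    {e : ι → X} (he : IsApproxOrderUnit e) {φ ψ : StrongDual ℝ X} (hφ : 0 ≤ φ) (hψ : 0 ≤ ψ) :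
    ‖φ + ψ‖ = ‖φ‖ + ‖ψ‖ :=
  tendsto_nhds_unique (he.2 _ fun x hx => add_nonneg (hφ x hx) (hψ x hx))
    ((he.2 φ hφ).add (he.2 ψ hψ))

variable (X) in
/-- The positive part of the closed unit ball of the dual, with the weak* topology. -/
def dualPosBall : Set (WeakDual ℝ X) := {φ | (∀ x, φ x ≤ ‖x‖) ∧ ∀ x, 0 ≤ x → 0 ≤ φ x}

theorem isClosed_setOf_weakDual_nonneg :
    IsClosed {φ : WeakDual ℝ X | ∀ x, 0 ≤ x → 0 ≤ φ x} := by
  simp only [Set.ofPred_forall]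
  exact isClosed_iInter fun x => isClosed_iInter fun _ =>
    isClosed_le continuous_const (WeakDual.eval_continuous x)

theorem isCompact_dualPosBall : IsCompact (dualPosBall X) :=
  isCompact_setOf_apply_le_norm.inter_right isClosed_setOf_weakDual_nonneg

/-- If the norm is additive on the dual cone, then only multiples of an extreme point `φ` of the
positive part of the dual ball lie between `0` and `φ`. -/
theorem apply_eq_norm_mul_of_mem_extremePoints
    (hadd : ∀ φ ψ : StrongDual ℝ X, 0 ≤ φ → 0 ≤ ψ → ‖φ + ψ‖ = ‖φ‖ + ‖ψ‖) {φ : StrongDual ℝ X}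
    (hφ : StrongDual.toWeakDual φ ∈ (dualPosBall X).extremePoints ℝ) {ψ : StrongDual ℝ X}
    (hψ : 0 ≤ ψ) (hle : ψ ≤ φ) (x : X) : ψ x = ‖ψ‖ * φ x := by
  have hmem : (∀ x, φ x ≤ ‖x‖) ∧ ∀ x, 0 ≤ x → 0 ≤ φ x :=
    (extremePoints_subset hφ : StrongDual.toWeakDual φ ∈ dualPosBall X)
  have hχ : 0 ≤ φ - ψ := fun x hx => sub_nonneg.2 (hle x hx)
  have hsum : ‖ψ‖ + ‖φ - ψ‖ ≤ 1 := by
    rw [← hadd _ _ hψ hχ, add_sub_cancel]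
    exact norm_le_one_of_apply_le hmem.1
  have hball : ∀ (r : ℝ) (χ : StrongDual ℝ X), 0 < r → 0 ≤ χ → ‖χ‖ ≤ r →
      StrongDual.toWeakDual (r⁻¹ • χ) ∈ dualPosBall X := by
    intro r χ hr hχ h
    refine ⟨fun x => ?_, fun x hx => mul_nonneg (inv_nonneg.2 hr.le) (hχ x hx)⟩
    refine apply_le_norm (φ := r⁻¹ • χ) ?_ x
    rw [norm_smul, Real.norm_of_nonneg (inv_nonneg.2 hr.le), inv_mul_le_iff₀ hr, mul_one]
    exact h
  rcases (norm_nonneg ψ).eq_or_lt with h0 | h0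
  · rw [norm_eq_zero.1 h0.symm]
    simp
  rcases (norm_nonneg (φ - ψ)).eq_or_lt with h1 | h1
  · have h2 : φ = ψ := sub_eq_zero.1 (norm_eq_zero.1 h1.symm)
    subst h2
    by_cases hn : ‖φ‖ = 1
    · rw [hn, one_mul]
    have hlt : ‖φ‖ < 1 := lt_of_le_of_ne (norm_le_one_of_apply_le hmem.1) hn
    -- If `0 < ‖φ‖ < 1`, then `φ` lies strictly between `0` and its normalisation.
    have hseg : StrongDual.toWeakDual φ ∈ openSegment ℝ
        (StrongDual.toWeakDual (‖φ‖⁻¹ • φ)) (StrongDual.toWeakDual (0 : StrongDual ℝ X)) := by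
      refine ⟨‖φ‖, 1 - ‖φ‖, h0, by linarith, by ring, ?_⟩
      rw [← map_smul, ← map_smul, ← map_add, smul_smul, mul_inv_cancel₀ h0.ne', one_smul,
        smul_zero, add_zero]
    have h3 := hφ.2 (hball _ _ h0 hψ le_rfl)
      ⟨fun x => norm_nonneg x, fun x _ => le_rfl⟩ hseg
    have h4 : ‖φ‖⁻¹ * φ x = φ x := congrArg (fun χ : WeakDual ℝ X => χ x) h3
    exact (inv_mul_eq_iff_eq_mul₀ h0.ne').1 h4
  -- Weighting `φ - ψ` by `1 - ‖ψ‖` instead of its norm avoids knowing that `‖φ‖ = 1`; `hsum` keeps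
  -- the rescaled functional in the ball.
  · have hq : 0 < 1 - ‖ψ‖ := by linarith
    have hseg : StrongDual.toWeakDual φ ∈ openSegment ℝ
        (StrongDual.toWeakDual (‖ψ‖⁻¹ • ψ))
        (StrongDual.toWeakDual ((1 - ‖ψ‖)⁻¹ • (φ - ψ))) := by
      refine ⟨‖ψ‖, 1 - ‖ψ‖, h0, hq, by ring, ?_⟩
      rw [← map_smul, ← map_smul, ← map_add, smul_smul, mul_inv_cancel₀ h0.ne', one_smul,
        smul_smul, mul_inv_cancel₀ hq.ne', one_smul, add_sub_cancel]
    have h3 := hφ.2 (hball _ _ h0 hψ le_rfl) (hball _ _ hq hχ (by linarith)) hseg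
    have h4 : ‖ψ‖⁻¹ * ψ x = φ x := congrArg (fun χ : WeakDual ℝ X => χ x) h3
    exact (inv_mul_eq_iff_eq_mul₀ h0.ne').1 h4

variable [CompleteSpace X] {P Q : X →ₗ[ℝ] X →ₗ[ℝ] X}

/-- For positive `ψ` and `‖a‖ ≤ 1`, `ψ a ≤ ‖ψ‖ = lim ψ (e i)`. With `ψ = φ (Q · x)` the limit is
also `φ x`, so `φ (Q a x) ≤ φ x`; the other side is symmetric. -/
theorem IsAMAlgebraProduct.isSubunital (hQ : IsAMAlgebraProduct Q) : IsSubunital Q := by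
  obtain ⟨hB, ι, _, _, _, e, he, hid⟩ := hQ
  have hL := hB.toIsLatticeAlgebraProduct
  have key : ∀ (ψ : StrongDual ℝ X) (a : X), 0 ≤ ψ → ‖a‖ ≤ 1 →
      ∀ r : ℝ, Tendsto (fun i => ψ (e i)) atTop (𝓝 r) → ψ a ≤ r := fun ψ a hψ ha r hr => by
    rw [tendsto_nhds_unique hr (he.2 ψ hψ)]
    exact (le_abs_self _).trans ((ψ.le_opNorm a).trans
      (mul_le_of_le_one_right (norm_nonneg _) ha))
  intro a x ha ha1 hx
  constructor
  · refine le_of_forall_apply_le fun φ hφ => ?_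
    exact key (φ.comp ((toBounded hL).flip x)) a (fun y hy => hφ _ (hL.pos _ _ hy hx)) ha1 _
      ((φ.continuous.tendsto x).comp (hid x).1)
  · refine le_of_forall_apply_le fun φ hφ => ?_
    exact key (φ.comp (toBounded hL x)) a (fun y hy => hφ _ (hL.pos _ _ hx hy)) ha1 _
      ((φ.continuous.tendsto x).comp (hid x).2)

/-- The lattice homomorphisms of norm one determine the norm of an AM-algebra. -/
theorem IsAMAlgebra.exists_mem_KOne_abs_apply_eq (hX : IsAMAlgebra X) {x : X} (hx : x ≠ 0) :
    ∃ φ ∈ KOne X, |φ x| = ‖x‖ := by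
  obtain ⟨Q, hQ⟩ := hX
  have hs := hQ.isSubunital
  obtain ⟨hB, ι, _, _, _, e, he, hid⟩ := hQ
  have hL := hB.toIsLatticeAlgebraProduct
  obtain ⟨φ₀, hφ₀, hφ₀1, hφ₀x⟩ := exists_nonneg_apply_eq_norm_posPart |x|
  rw [posPart_of_nonneg (abs_nonneg x), norm_abs_eq_norm] at hφ₀x
  obtain ⟨ω, hω, hωx⟩ := exists_extremePoint_apply_eq isCompact_dualPosBall
    (φ₀ := StrongDual.toWeakDual φ₀) ⟨apply_le_norm hφ₀1, hφ₀⟩ |x|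
    (fun φ hφ => (hφ.1 _).trans (by
      change _ ≤ φ₀ |x|
      rw [hφ₀x, norm_abs_eq_norm]))
  set φ : StrongDual ℝ X := WeakDual.toStrongDual ω with hφdef
  have hφx : φ |x| = ‖x‖ := hωx.trans hφ₀x
  have hmem : (∀ x, φ x ≤ ‖x‖) ∧ ∀ x, 0 ≤ x → 0 ≤ φ x :=
    (extremePoints_subset hω : ω ∈ dualPosBall X)
  have hφ : 0 ≤ φ := hmem.2
  have hatom : ∀ ψ : StrongDual ℝ X, 0 ≤ ψ → ψ ≤ φ → ∀ x, ψ x = ‖ψ‖ * φ x :=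
    fun ψ h0 h1 => apply_eq_norm_mul_of_mem_extremePoints
      (fun _ _ h h' => he.norm_add h h') hω h0 h1
  have hne : φ |x| ≠ 0 := hφx ▸ norm_ne_zero_iff.2 hx
  -- The atom relation applied to `φ` itself reads `φ |x| = ‖φ‖ * φ |x|`.
  have hnorm : ‖φ‖ = 1 := by
    have h := hatom φ hφ le_rfl |x|
    exact (mul_eq_right₀ hne).1 h.symm
  have hmul := hs.apply_mul_of_tendsto hL hφ (fun ψ h0 h1 => ⟨_, hatom ψ h0 h1⟩)
    (fun x => (hid x).1) (hnorm ▸ he.2 φ hφ)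
  have hlat : φ ∈ latticeHoms X := mem_latticeHoms_of_mul_eq_zero hφ fun z => by
    rw [← hmul, hs.apply_eq_zero hL (posPart_nonneg z) (negPart_nonneg z)
      (posPart_inf_negPart_eq_zero z), map_zero]
  refine ⟨φ, ⟨hlat, hnorm⟩, ?_⟩
  rw [← apply_abs_of_mem_latticeHoms hlat, hφx]

theorem IsAMAlgebra.eq_of_forall_apply_eq (hX : IsAMAlgebra X) {x y : X}
    (h : ∀ φ ∈ KOne X, φ x = φ y) : x = y := by
  by_contra hne
  have hxy := sub_ne_zero.2 hne
  obtain ⟨φ, hφ, h1⟩ := hX.exists_mem_KOne_abs_apply_eq hxy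
  rw [map_sub, h φ hφ, sub_self, abs_zero] at h1
  exact hxy (norm_eq_zero.1 h1.symm)

theorem IsAMAlgebraProduct.apply_mul (hQ : IsAMAlgebraProduct Q) {φ : StrongDual ℝ X}
    (hφ : φ ∈ KOne X) (x y : X) : φ (Q x y) = φ x * φ y := by
  have hs := hQ.isSubunital
  obtain ⟨hB, ι, _, _, _, e, he, hid⟩ := hQ
  have h0 := nonneg_of_mem_latticeHoms hφ.1
  exact hs.apply_mul_of_tendsto hB.toIsLatticeAlgebraProduct h0
    (fun ψ h h' => exists_eq_mul_of_le_latticeHom hφ.1 h h') (fun x => (hid x).1)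
    (hφ.2 ▸ he.2 φ h0) x y

theorem IsAMAlgebraProduct.eq_of_apply_mul (hQ : IsAMAlgebraProduct Q)
    (h : ∀ φ ∈ KOne X, ∀ x y, φ (P x y) = φ x * φ y) : P = Q :=
  LinearMap.ext₂ fun x y => IsAMAlgebra.eq_of_forall_apply_eq ⟨Q, hQ⟩ fun φ hφ => by
    rw [h φ hφ, hQ.apply_mul hφ]

instance : Nonempty (PosBall X) := ⟨⟨0, le_rfl, by simp⟩⟩

/-- The unit ball is closed under suprema of positive elements, because the norm is computed by
lattice homomorphisms, which turn `⊔` into a maximum of reals. -/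
theorem IsAMAlgebra.isDirectedOrder_posBall (hX : IsAMAlgebra X) :
    IsDirectedOrder (PosBall X) := by
  refine ⟨fun a b => ?_⟩
  refine ⟨⟨a.1 ⊔ b.1, a.2.1.trans le_sup_left, ?_⟩, (le_sup_left : a.1 ≤ _),
    (le_sup_right : b.1 ≤ _)⟩
  rcases eq_or_ne (a.1 ⊔ b.1) 0 with h | h
  · simp [h]
  obtain ⟨φ, hφ, h1⟩ := hX.exists_mem_KOne_abs_apply_eq h
  have h0 := nonneg_of_mem_latticeHoms hφ.1
  have ha := (apply_le_norm hφ.2.le a.1).trans a.2.2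
  have hb := (apply_le_norm hφ.2.le b.1).trans b.2.2
  rw [← h1, abs_of_nonneg (h0 _ (a.2.1.trans le_sup_left)), (hφ.1 _ _).1]
  exact sup_le ha hb

theorem isLUB_range_posBall {φ : StrongDual ℝ X} (hφ : 0 ≤ φ) :
    IsLUB (Set.range fun b : PosBall X => φ b) ‖φ‖ := by
  constructor
  · rintro _ ⟨b, rfl⟩
    exact (le_abs_self _).trans ((φ.le_opNorm _).trans
      (mul_le_of_le_one_right (norm_nonneg _) b.2.2))
  · intro c hc
    have hc' : ∀ b : PosBall X, φ b ≤ c := fun b => hc ⟨b, rfl⟩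
    have hc0 : 0 ≤ c := by simpa using hc' ⟨0, le_rfl, by simp⟩
    refine φ.opNorm_le_bound hc0 fun x => (abs_apply_le hφ x).trans ?_
    rcases eq_or_ne x 0 with rfl | hx
    · simp
    have hx0 : 0 < ‖x‖ := norm_pos_iff.2 hx
    have := hc' ⟨‖x‖⁻¹ • |x|, smul_nonneg (by positivity) (abs_nonneg x), by
      rw [norm_smul, norm_abs_eq_norm, norm_inv, norm_norm, inv_mul_cancel₀ hx0.ne']⟩
    rw [map_smul, smul_eq_mul, inv_mul_le_iff₀ hx0] at this
    linarith

/-- The positive part of the unit ball is an approximate order unit once it is directed. -/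
theorem isApproxOrderUnit_posBall : IsApproxOrderUnit (fun b : PosBall X => (b : X)) :=
  ⟨fun b => b.2.1, fun _ hφ => tendsto_atTop_isLUB (fun _ _ h => apply_mono hφ h)
    (isLUB_range_posBall hφ)⟩

/-- Eventually `a ≤ b` along the net, so `P a x ≤ P b x`, and the right side tends to `x`. -/
theorem isSubunital_of_isApproxIdentity_posBall [IsDirectedOrder (PosBall X)]
    (hP : IsLatticeAlgebraProduct P) (h : IsApproxIdentity P (fun b : PosBall X => (b : X))) :
    IsSubunital P := by
  intro a x ha ha1 hx
  constructor
  · refine ge_of_tendsto (h x).1 ((eventually_ge_atTop (⟨a, ha, ha1⟩ : PosBall X)).mono ?_)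
    intro b hb
    have := hP.pos _ _ (sub_nonneg.2 (show a ≤ b.1 from hb)) hx
    rwa [map_sub, LinearMap.sub_apply, sub_nonneg] at this
  · refine ge_of_tendsto (h x).2 ((eventually_ge_atTop (⟨a, ha, ha1⟩ : PosBall X)).mono ?_)
    intro b hb
    have := hP.pos _ _ hx (sub_nonneg.2 (show a ≤ b.1 from hb))
    rwa [map_sub, sub_nonneg] at this

theorem apply_mul_of_isApproxIdentity_posBall [IsDirectedOrder (PosBall X)]
    (hP : IsLatticeAlgebraProduct P) (h : IsApproxIdentity P (fun b : PosBall X => (b : X)))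
    {φ : StrongDual ℝ X} (hφ : φ ∈ KOne X) (x y : X) : φ (P x y) = φ x * φ y := by
  have h0 := nonneg_of_mem_latticeHoms hφ.1
  exact (isSubunital_of_isApproxIdentity_posBall hP h).apply_mul_of_tendsto hP h0
    (fun ψ h h' => exists_eq_mul_of_le_latticeHom hφ.1 h h') (fun x => (h x).1)
    (by simpa only [hφ.2] using isApproxOrderUnit_posBall.2 φ h0) x y

/-- By Bernoulli `(1 + n * s) * (1 - s) ^ n ≤ (1 - s ^ 2) ^ n ≤ 1`, and `(n + 1) * s ≤ 1 + n * s`.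
The bound is uniform in `s`, hence a norm estimate for functions. -/
theorem mul_one_sub_pow_le {s : ℝ} (h0 : 0 ≤ s) (h1 : s ≤ 1) (n : ℕ) :
    s * (1 - s) ^ n ≤ 1 / (n + 1) := by
  have hb : 1 + (n : ℝ) * s ≤ (1 + s) ^ n := one_add_mul_le_pow (by linarith) n
  have hp : 0 ≤ (1 - s) ^ n := pow_nonneg (by linarith) n
  have h2 : (1 + n * s) * (1 - s) ^ n ≤ 1 := by
    calc (1 + n * s) * (1 - s) ^ n ≤ (1 + s) ^ n * (1 - s) ^ n :=
          mul_le_mul_of_nonneg_right hb hp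
      _ = (1 - s ^ 2) ^ n := by rw [← mul_pow]; ring
      _ ≤ 1 := pow_le_one₀ (by nlinarith) (by nlinarith)
  rw [le_div_iff₀ (by positivity)]
  nlinarith

/-- A product that is represented by the pointwise product of real functions has the positive part
of the unit ball as approximate identity. -/
theorem isApproxIdentity_posBall_of_representation [IsDirectedOrder (PosBall X)] {K : Type*}
    (T : X →ₗ[ℝ] (K → ℝ)) (hpos : ∀ x, 0 ≤ T x ↔ 0 ≤ x)
    (hnorm : ∀ (x : X) (c : ℝ), 0 ≤ c → (‖x‖ ≤ c ↔ ∀ t, |T x t| ≤ c))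
    (hmul : ∀ x y, T (P x y) = T x * T y) :
    IsApproxIdentity P (fun b : PosBall X => (b : X)) := by
  have hinj : ∀ x y, T x = T y → x = y := fun x y h => by
    rw [← sub_eq_zero, ← norm_le_zero_iff, hnorm _ _ le_rfl]
    intro t
    rw [map_sub, h, sub_self]
    simp
  have hcomm : ∀ x y, P x y = P y x := fun x y => hinj _ _ (by rw [hmul, hmul, mul_comm])
  have hT0 : ∀ b : PosBall X, ∀ t, 0 ≤ T b t := fun b => (hpos _).2 b.2.1
  have hT1 : ∀ b : PosBall X, ∀ t, T b t ≤ 1 := fun b t =>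
    (le_abs_self _).trans ((hnorm _ _ zero_le_one).1 b.2.2 t)
  have key : ∀ a : PosBall X, Tendsto (fun b : PosBall X => P b a) atTop (𝓝 (a : X)) := by
    intro a
    -- `1 - (1 - a) ^ n` is a polynomial in `a` without constant term, so it exists in `X` even
    -- without a unit.
    have hb : ∀ n : ℕ, ∃ b : X, ∀ t, T b t = 1 - (1 - T a t) ^ n := by
      intro n
      induction n with
      | zero => exact ⟨0, fun t => by simp⟩
      | succ n ih =>
        obtain ⟨b, hb⟩ := ih
        refine ⟨b + a - P a b, fun t => ?_⟩
        rw [map_sub, map_add, hmul, Pi.sub_apply, Pi.add_apply, Pi.mul_apply, hb]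
        ring
    rw [Metric.tendsto_nhds]
    intro ε hε
    obtain ⟨n, hn⟩ := exists_nat_one_div_lt hε
    obtain ⟨b, hb⟩ := hb n
    have hp : ∀ t, 0 ≤ (1 - T a t) ^ n := fun t => pow_nonneg (by linarith [hT1 a t]) n
    have hp1 : ∀ t, (1 - T a t) ^ n ≤ 1 := fun t =>
      pow_le_one₀ (by linarith [hT1 a t]) (by linarith [hT0 a t])
    have hbB : 0 ≤ b ∧ ‖b‖ ≤ 1 := by
      refine ⟨(hpos b).1 fun t => ?_, (hnorm b 1 zero_le_one).2 fun t => ?_⟩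
      · rw [hb]
        exact sub_nonneg.2 (hp1 t)
      · rw [hb, abs_le]
        constructor <;> linarith [hp t, hp1 t]
    -- For `c ≥ b`, pointwise `0 ≤ a * (1 - c) ≤ a * (1 - b) = a * (1 - a) ^ n ≤ 1 / (n + 1)`.
    filter_upwards [eventually_ge_atTop (⟨b, hbB⟩ : PosBall X)] with c hc
    rw [dist_eq_norm]
    refine lt_of_le_of_lt ((hnorm _ _ (by positivity)).2 fun t => ?_) hn
    have h1 : T b t ≤ T c t := by
      have := (hpos (c.1 - b)).2 (sub_nonneg.2 hc) t
      rw [map_sub] at this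
      exact sub_nonneg.1 this
    rw [map_sub, hmul, Pi.sub_apply, Pi.mul_apply, abs_sub_comm]
    rw [hb] at h1
    have h2 := mul_one_sub_pow_le (hT0 a t) (hT1 a t) n
    have h3 := hT0 a t
    have h4 := hT1 c t
    rw [abs_of_nonneg (by nlinarith)]
    nlinarith
  have key' : ∀ x : X, Tendsto (fun b : PosBall X => P b x) atTop (𝓝 x) := by
    have hx : ∀ x : X, 0 ≤ x → Tendsto (fun b : PosBall X => P b x) atTop (𝓝 x) := by
      intro x hx
      obtain ⟨c, a, -, ha, ha1, rfl⟩ := exists_smul_eq_of_nonneg hx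
      simp only [map_smul]
      exact (key ⟨a, ha, ha1⟩).const_smul c
    intro x
    have := (hx _ (posPart_nonneg x)).sub (hx _ (negPart_nonneg x))
    simpa only [← map_sub, posPart_sub_negPart] using this
  intro x
  refine ⟨key' x, ?_⟩
  simp only [hcomm x]
  exact key' x

theorem IsLatticeAlgebraHom.nonneg_iff {K F : Type*} [FunLike F K ℝ] {T : X → F}
    (hT : IsLatticeAlgebraHom P T) (hzero : ∀ t, T 0 t = 0)
    (hinj : ∀ x y, (∀ t, T x t = T y t) → x = y) (x : X) : (∀ t, 0 ≤ T x t) ↔ 0 ≤ x := by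
  constructor
  · intro h
    rw [← sup_eq_left]
    refine hinj _ _ fun t => ?_
    rw [(hT x 0 t).1, hzero, sup_eq_left.2 (h t)]
  · intro h t
    have := (hT x 0 t).1
    rw [sup_eq_left.2 h, hzero] at this
    rw [this]
    exact le_sup_right

theorem isApproxIdentity_posBall_of_isLatticeAlgebraHom [IsDirectedOrder (PosBall X)]
    {K F : Type*} [FunLike F K ℝ] (T : X → F)
    (hT : IsLatticeAlgebraHom P T) (hadd : ∀ x y t, T (x + y) t = T x t + T y t)
    (hsmul : ∀ (c : ℝ) x t, T (c • x) t = c * T x t)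
    (hnorm : ∀ (x : X) (c : ℝ), 0 ≤ c → (‖x‖ ≤ c ↔ ∀ t, |T x t| ≤ c)) :
    IsApproxIdentity P (fun b : PosBall X => (b : X)) := by
  let T' : X →ₗ[ℝ] (K → ℝ) :=
    { toFun := fun x t => T x t
      map_add' := fun x y => funext fun t => hadd x y t
      map_smul' := fun c x => funext fun t => hsmul c x t }
  have hT' : ∀ x t, T' x t = T x t := fun _ _ => rfl
  have hinj : ∀ x y, (∀ t, T x t = T y t) → x = y := fun x y h => by
    rw [← sub_eq_zero, ← norm_le_zero_iff, hnorm _ _ le_rfl]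
    intro t
    rw [← hT', map_sub, Pi.sub_apply, hT', hT', h, sub_self, abs_zero]
  refine isApproxIdentity_posBall_of_representation T' (fun x => ?_) hnorm
    (fun x y => funext fun t => (hT x y t).2.2)
  exact hT.nonneg_iff (fun t => by simpa using hsmul 0 0 t) hinj x

end AMAlgebra

/-! ### Functions vanishing at a point as functions vanishing at infinity. -/

section VanishingAtPoint

open scoped ZeroAtInfty

variable {K : Type u} [TopologicalSpace K] [CompactSpace K] [T2Space K]

theorem tendsto_val_cocompact_nhds (k : K) :
    Tendsto (Subtype.val : {t : K // t ≠ k} → K) (cocompact _) (𝓝 k) := by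
  intro U hU
  obtain ⟨V, hVU, hV, hk⟩ := mem_nhds_iff.1 hU
  rw [mem_map, mem_cocompact]
  refine ⟨Subtype.val ⁻¹' Vᶜ, ?_, fun t ht => hVU (by simpa using ht)⟩
  rw [Topology.IsInducing.isCompact_iff (f := (Subtype.val : {t : K // t ≠ k} → K))
    Topology.IsInducing.subtypeVal, Set.image_preimage_eq_of_subset]
  · exact hV.isClosed_compl.isCompact
  · intro t ht
    have : t ≠ k := fun h => ht (h ▸ hk)
    exact ⟨⟨t, this⟩, rfl⟩

/-- Functions on `K` vanishing at `k`, restricted to the complement of `k`. -/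
def restrictZeroAtInfty (k : K) (f : C(K, ℝ)) (hf : f k = 0) : C₀({t : K // t ≠ k}, ℝ) where
  toFun t := f t
  continuous_toFun := f.continuous.comp continuous_subtype_val
  zero_at_infty' := by
    have := (f.continuous.tendsto k).comp (tendsto_val_cocompact_nhds k)
    rwa [hf] at this

open Classical in
/-- A function vanishing at infinity on the complement of a point extends by zero. -/
theorem exists_extension_zeroAtInfty (k : K) (g : C₀({t : K // t ≠ k}, ℝ)) :
    ∃ f : C(K, ℝ), f k = 0 ∧ ∀ t : {t : K // t ≠ k}, f t = g t := by
  let f : K → ℝ := fun t => if h : t ≠ k then g ⟨t, h⟩ else 0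
  have hfg : ∀ t : {t : K // t ≠ k}, f t = g t := fun t => dif_pos t.2
  have hfk : f k = 0 := dif_neg (by simp)
  refine ⟨⟨f, continuous_iff_continuousAt.2 fun t => ?_⟩, hfk, hfg⟩
  by_cases ht : t = k
  · subst ht
    rw [ContinuousAt, hfk, Metric.tendsto_nhds]
    intro ε hε
    have h := Metric.tendsto_nhds.1 (zero_at_infty g) ε hε
    obtain ⟨C, hC, hCg⟩ := mem_cocompact.1 h
    -- A compact set off which `g` is small stays closed in `K` and misses the point, so its
    -- complement is a neighbourhood.
    have hcl : IsClosed (Subtype.val '' C : Set K) :=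
      (hC.image continuous_subtype_val).isClosed
    have hmem : (Subtype.val '' C : Set K)ᶜ ∈ 𝓝 t := hcl.isOpen_compl.mem_nhds (by
      rintro ⟨s, -, hs⟩
      exact s.2 hs)
    filter_upwards [hmem] with s hs
    by_cases hst : s = t
    · rw [hst, hfk, dist_self]
      exact hε
    · have : (⟨s, hst⟩ : {s : K // s ≠ t}) ∈ Cᶜ := fun h => hs ⟨_, h, rfl⟩
      rw [hfg ⟨s, hst⟩]
      exact hCg this
  · have hopen : Topology.IsOpenEmbedding (Subtype.val : {t : K // t ≠ k} → K) :=
      isOpen_ne.isOpenEmbedding_subtypeVal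
    have := hopen.continuousAt_iff (g := f) (x := ⟨t, ht⟩)
    rw [← this]
    have hcomp : f ∘ Subtype.val = g := funext hfg
    rw [hcomp]
    exact g.continuous.continuousAt

theorem zeroAtInfty_norm_le {Ω : Type*} [TopologicalSpace Ω] (f : C₀(Ω, ℝ)) {c : ℝ} (hc : 0 ≤ c) :
    ‖f‖ ≤ c ↔ ∀ t, |f t| ≤ c := by
  rw [← ZeroAtInftyContinuousMap.norm_toBCF_eq_norm, BoundedContinuousFunction.norm_le hc]
  rfl

end VanishingAtPoint

/-! ### Representation of `X` by continuous functions. -/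

section Representation

variable {X : Type u} [NormedAddCommGroup X] [NormedSpace ℝ X] [Lattice X]
  [IsOrderedAddMonoid X] [IsOrderedModule ℝ X] [HasSolidNorm X] [CompleteSpace X]
  {P : X →ₗ[ℝ] X →ₗ[ℝ] X}

/-- An AM-algebra is the algebra of all continuous functions vanishing at a given point of a compact
Hausdorff space. -/
theorem IsAMAlgebra.exists_representation (hX : IsAMAlgebra X)
    (hmul : ∀ φ ∈ KOne X, ∀ x y, φ (P x y) = φ x * φ y) :
    ∃ (K : Type u) (_ : TopologicalSpace K) (_ : CompactSpace K) (_ : T2Space K) (k : K)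
      (T : X →ₗᵢ[ℝ] C(K, ℝ)), Set.range T = {f | f k = 0} ∧ IsLatticeAlgebraHom P T := by
  let C : Set (WeakDual ℝ X) := {φ | (∀ x, φ x ≤ ‖x‖) ∧
    (∀ x y, φ (x ⊔ y) = φ x ⊔ φ y ∧ φ (x ⊓ y) = φ x ⊓ φ y ∧ φ (P x y) = φ x * φ y)}
  have hC : IsCompact C := by
    refine isCompact_setOf_apply_le_norm.inter_right (t := {φ : WeakDual ℝ X | ∀ x y,
      φ (x ⊔ y) = φ x ⊔ φ y ∧ φ (x ⊓ y) = φ x ⊓ φ y ∧ φ (P x y) = φ x * φ y}) ?_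
    have hev := fun z : X => WeakDual.eval_continuous (𝕜 := ℝ) z
    simp only [Set.ofPred_forall, Set.ofPred_and]
    exact isClosed_iInter fun x => isClosed_iInter fun y =>
      (isClosed_eq (hev _) ((hev x).sup (hev y))).inter
        ((isClosed_eq (hev _) ((hev x).inf (hev y))).inter
          (isClosed_eq (hev _) ((hev x).mul (hev y))))
  have : CompactSpace C := isCompact_iff_compactSpace.1 hC
  -- The zero functional is kept: it makes the set compact and is the point where every `T x`
  -- vanishes.
  let k : C := ⟨0, fun x => norm_nonneg x, fun x y => by
    change (0 : ℝ) = 0 ⊔ 0 ∧ (0 : ℝ) = 0 ⊓ 0 ∧ (0 : ℝ) = 0 * 0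
    simp⟩
  let Tl : X →ₗ[ℝ] C(C, ℝ) :=
    { toFun := fun x => ⟨fun ω => ω.1 x, (WeakDual.eval_continuous x).comp continuous_subtype_val⟩
      map_add' := fun x y => by ext ω; exact map_add ω.1 x y
      map_smul' := fun c x => by ext ω; exact map_smul ω.1 c x }
  have hnorm : ∀ x, ‖Tl x‖ = ‖x‖ := by
    intro x
    refine le_antisymm ((ContinuousMap.norm_le _ (norm_nonneg x)).2 fun ω =>
      (abs_le'.2 ⟨ω.2.1 x, by simpa using ω.2.1 (-x)⟩ : |ω.1 x| ≤ ‖x‖)) ?_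
    rcases eq_or_ne x 0 with rfl | hx
    · simp
    obtain ⟨φ, hφ, h⟩ := hX.exists_mem_KOne_abs_apply_eq hx
    rw [← h]
    exact (Tl x).norm_coe_le_norm ⟨StrongDual.toWeakDual φ, apply_le_norm hφ.2.le,
      fun x y => ⟨(hφ.1 x y).1, (hφ.1 x y).2, hmul φ hφ x y⟩⟩
  let T : X →ₗᵢ[ℝ] C(C, ℝ) := ⟨Tl, hnorm⟩
  have hT : ∀ x (ω : C), T x ω = ω.1 x := fun _ _ => rfl
  have hThom : IsLatticeAlgebraHom P T := fun x y ω => ω.2.2 x y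
  have hTk : ∀ x, T x k = 0 := fun x => rfl
  refine ⟨C, inferInstance, inferInstance, inferInstance, k, T, ?_, hThom⟩
  -- `S` is the range of `T` plus the constants, the unital algebra to which Stone–Weierstrass
  -- applies.
  let S : Subalgebra ℝ C(C, ℝ) :=
    { carrier := {f | ∃ x, ∀ ω, f ω = T x ω + f k}
      mul_mem' := by
        rintro f g ⟨x, hx⟩ ⟨y, hy⟩
        refine ⟨P x y + g k • x + f k • y, fun ω => ?_⟩
        rw [map_add, map_add, map_smul, map_smul, ContinuousMap.add_apply,
          ContinuousMap.add_apply, (hThom x y ω).2.2, ContinuousMap.mul_apply,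
          ContinuousMap.mul_apply, ContinuousMap.smul_apply, ContinuousMap.smul_apply, hx ω, hy ω]
        simp only [smul_eq_mul]
        ring
      add_mem' := by
        rintro f g ⟨x, hx⟩ ⟨y, hy⟩
        refine ⟨x + y, fun ω => ?_⟩
        rw [map_add, ContinuousMap.add_apply, ContinuousMap.add_apply, ContinuousMap.add_apply,
          hx ω, hy ω]
        ring
      algebraMap_mem' := fun r => ⟨0, fun ω => by simp⟩ }
  have hsep : S.SeparatesPoints := by
    intro ω χ hne
    have : ∃ x, ω.1 x ≠ χ.1 x := by
      by_contra! h
      exact hne (Subtype.ext (DFunLike.ext _ _ h))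
    obtain ⟨x, hx⟩ := this
    exact ⟨T x, ⟨T x, ⟨x, fun ω => by rw [hTk, add_zero]⟩, rfl⟩, hx⟩
  have hrange : IsClosed (Set.range T) := T.isometry.isClosedEmbedding.isClosed_range
  have hS : (S : Set C(C, ℝ)) = (fun f => f - ContinuousMap.const C (f k)) ⁻¹' Set.range T := by
    ext f
    refine exists_congr fun x => ⟨fun h => ?_, fun h ω => ?_⟩
    · ext ω
      change _ = f ω - f k
      rw [h ω]
      ring
    · rw [h]
      change f ω = f ω - f k + f k
      ring
  have hclosed : IsClosed (S : Set C(C, ℝ)) := by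
    rw [hS]
    refine hrange.preimage (continuous_id.sub ?_)
    exact ContinuousMap.continuous_const'.comp (continuous_eval_const k)
  have htop := ContinuousMap.subalgebra_topologicalClosure_eq_top_of_separatesPoints S hsep
  ext f
  constructor
  · rintro ⟨x, rfl⟩
    exact hTk x
  · intro hf
    have hfS : f ∈ S.topologicalClosure := htop ▸ Algebra.mem_top
    rw [← SetLike.mem_coe, Subalgebra.topologicalClosure_coe, hclosed.closure_eq] at hfS
    obtain ⟨x, hx⟩ := hfS
    refine ⟨x, ?_⟩
    ext ω
    rw [hx ω, show f k = 0 from hf, add_zero]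

theorem IsAMAlgebra.exists_closedIdeal (hX : IsAMAlgebra X)
    (hmul : ∀ φ ∈ KOne X, ∀ x y, φ (P x y) = φ x * φ y) :
    ∃ (K : Type u) (_ : TopologicalSpace K) (_ : CompactSpace K) (_ : T2Space K)
      (I : Ideal C(K, ℝ)) (T : X →ₗᵢ[ℝ] C(K, ℝ)), IsClosed (I : Set C(K, ℝ)) ∧
        Set.range T = (I : Set C(K, ℝ)) ∧ IsLatticeAlgebraHom P T := by
  obtain ⟨K, _, _, _, k, T, hr, hT⟩ := hX.exists_representation hmul
  refine ⟨K, inferInstance, inferInstance, inferInstance, ContinuousMap.idealOfSet ℝ {k}ᶜ, T,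
    ContinuousMap.idealOfSet_closed _ _, ?_, hT⟩
  rw [hr]
  ext f
  simp [ContinuousMap.mem_idealOfSet]

open scoped ZeroAtInfty in
theorem IsAMAlgebra.exists_zeroAtInfty (hX : IsAMAlgebra X)
    (hmul : ∀ φ ∈ KOne X, ∀ x y, φ (P x y) = φ x * φ y) :
    ∃ (Ω : Type u) (_ : TopologicalSpace Ω) (_ : LocallyCompactSpace Ω) (_ : T2Space Ω)
      (T : X ≃ₗᵢ[ℝ] C₀(Ω, ℝ)), IsLatticeAlgebraHom P T := by
  obtain ⟨K, _, _, _, k, T, hr, hT⟩ := hX.exists_representation hmul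
  have hTk : ∀ x, T x k = 0 := fun x => (hr ▸ Set.mem_range_self x : T x ∈ {f : C(K, ℝ) | f k = 0})
  let Tl : X →ₗ[ℝ] C₀({t : K // t ≠ k}, ℝ) :=
    { toFun := fun x => restrictZeroAtInfty k (T x) (hTk x)
      map_add' := fun x y => by
        ext t
        change T (x + y) t = T x t + T y t
        rw [map_add, ContinuousMap.add_apply]
      map_smul' := fun c x => by
        ext t
        change T (c • x) t = c • T x t
        rw [map_smul, ContinuousMap.smul_apply] }
  have hTl : ∀ x t, Tl x t = T x t := fun _ _ => rfl
  have hnorm : ∀ x, ‖Tl x‖ = ‖x‖ := by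
    intro x
    have key : ∀ c, 0 ≤ c → (‖Tl x‖ ≤ c ↔ ‖x‖ ≤ c) := fun c hc => by
      rw [zeroAtInfty_norm_le _ hc, ← T.norm_map, ContinuousMap.norm_le _ hc]
      refine ⟨fun h t => ?_, fun h t => h t⟩
      by_cases ht : t = k
      · rw [ht, hTk, norm_zero]
        exact hc
      · exact h ⟨t, ht⟩
    exact le_antisymm ((key _ (norm_nonneg _)).2 le_rfl) ((key _ (norm_nonneg _)).1 le_rfl)
  have hsurj : Function.Surjective (⟨Tl, hnorm⟩ : X →ₗᵢ[ℝ] C₀({t : K // t ≠ k}, ℝ)) := by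
    intro g
    obtain ⟨f, hf, hfg⟩ := exists_extension_zeroAtInfty k g
    obtain ⟨x, hx⟩ : f ∈ Set.range T := hr ▸ hf
    refine ⟨x, ?_⟩
    ext t
    change T x t = g t
    rw [hx, hfg]
  exact ⟨{t : K // t ≠ k}, inferInstance, isOpen_ne.locallyCompactSpace, inferInstance,
    LinearIsometryEquiv.ofSurjective _ hsurj, fun x y t => hT x y t⟩

end Representation

/-! ### Compatibility of the dual order with addition and scalars. -/

section DualOrder

variable {E : Type*} [NormedAddCommGroup E] [NormedSpace ℝ E] [Preorder E]

instance : IsOrderedAddMonoid (StrongDual ℝ E) where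
  add_le_add_left _ _ h c x hx := add_le_add_left (h x hx) (c x)

instance : PosSMulMono ℝ (StrongDual ℝ E) where
  smul_le_smul_of_nonneg_left _ hc _ _ h x hx := mul_le_mul_of_nonneg_left (h x hx) hc

end DualOrder

/-! ### The bidual and the Arens products. -/

section Bidual

variable {X : Type u} [NormedAddCommGroup X] [NormedSpace ℝ X] [Lattice X]
  [IsOrderedAddMonoid X] [IsOrderedModule ℝ X] [HasSolidNorm X] [CompleteSpace X]
  {P : X →ₗ[ℝ] X →ₗ[ℝ] X}

theorem convex_dualPosBall : Convex ℝ (dualPosBall X) := by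
  intro φ hφ ψ hψ a b ha hb hab
  refine ⟨fun x => ?_, fun x hx => ?_⟩
  · change a * φ x + b * ψ x ≤ ‖x‖
    calc a * φ x + b * ψ x ≤ a * ‖x‖ + b * ‖x‖ :=
          add_le_add (mul_le_mul_of_nonneg_left (hφ.1 x) ha)
            (mul_le_mul_of_nonneg_left (hψ.1 x) hb)
      _ = ‖x‖ := by rw [← add_mul, hab, one_mul]
  · exact add_nonneg (mul_nonneg ha (hφ.2 x hx)) (mul_nonneg hb (hψ.2 x hx))

/-- A Jordan decomposition of the functionals on an AM-algebra. -/
theorem IsAMAlgebra.exists_decomposition (hX : IsAMAlgebra X) (φ : StrongDual ℝ X) :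
    ∃ φ₁ φ₂ : StrongDual ℝ X, 0 ≤ φ₁ ∧ 0 ≤ φ₂ ∧ φ = φ₁ - φ₂ ∧ ‖φ₁ + φ₂‖ ≤ ‖φ‖ := by
  -- The differences `p - q` with `p`, `q`, `p + q` in the positive ball form a weak* compact convex
  -- set `D`. If a unit-ball functional `ψ` were outside, some `x` would separate it; but `± ω ∈ D`
  -- for the `ω ∈ KOne X` norming `x`, so `‖x‖ ≤ r < ψ x ≤ ‖x‖`.
  let B : Set (WeakDual ℝ X × WeakDual ℝ X) :=
    (dualPosBall X ×ˢ dualPosBall X) ∩ {p | p.1 + p.2 ∈ dualPosBall X}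
  have hB : IsCompact B := (isCompact_dualPosBall.prod isCompact_dualPosBall).inter_right
    (isCompact_dualPosBall.isClosed.preimage (continuous_fst.add continuous_snd))
  have hBc : Convex ℝ B := (convex_dualPosBall.prod convex_dualPosBall).inter
    (convex_dualPosBall.linear_preimage
      (LinearMap.fst ℝ (WeakDual ℝ X) (WeakDual ℝ X) +
        LinearMap.snd ℝ (WeakDual ℝ X) (WeakDual ℝ X)))
  let D : Set (WeakDual ℝ X) := (fun p => p.1 - p.2) '' B
  have hD : IsClosed D := (hB.image (continuous_fst.sub continuous_snd)).isClosed
  have hDc : Convex ℝ D := hBc.linear_image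
    (LinearMap.fst ℝ (WeakDual ℝ X) (WeakDual ℝ X) - LinearMap.snd ℝ _ _)
  have h0 : (0 : WeakDual ℝ X) ∈ dualPosBall X := ⟨fun x => norm_nonneg x, fun x _ => le_rfl⟩
  have hDpos : ∀ ω ∈ dualPosBall X, ω ∈ D ∧ -ω ∈ D := fun ω hω =>
    ⟨⟨(ω, 0), ⟨⟨hω, h0⟩, by simpa using hω⟩, sub_zero ω⟩,
      ⟨(0, ω), ⟨⟨h0, hω⟩, by simpa using hω⟩, zero_sub ω⟩⟩
  have key : ∀ ψ : StrongDual ℝ X, ‖ψ‖ ≤ 1 → StrongDual.toWeakDual ψ ∈ D := by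
    intro ψ hψ
    by_contra hmem
    obtain ⟨l, r, hl, hr⟩ := geometric_hahn_banach_closed_point hDc hD hmem
    obtain ⟨x, hx⟩ := exists_eval_eq l
    have hr0 : 0 < r := by simpa using hl 0 (hDpos 0 h0).1
    have h1 : r < ψ x := by
      rw [hx] at hr
      exact hr
    have hx0 : x ≠ 0 := by
      rintro rfl
      rw [map_zero] at h1
      linarith
    obtain ⟨ω, hω, hωx⟩ := hX.exists_mem_KOne_abs_apply_eq hx0
    obtain ⟨h2, h3⟩ := hDpos (StrongDual.toWeakDual ω)
      ⟨apply_le_norm hω.2.le, nonneg_of_mem_latticeHoms hω.1⟩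
    have h4 := hl _ h2
    have h5 := hl _ h3
    rw [hx] at h4 h5
    change ω x < r at h4
    change -ω x < r at h5
    have h6 := apply_le_norm hψ x
    have h7 : |ω x| ≤ r := abs_le'.2 ⟨h4.le, h5.le⟩
    linarith
  rcases eq_or_ne φ 0 with rfl | hφ
  · exact ⟨0, 0, le_rfl, le_rfl, by simp, by simp⟩
  have hφ0 : 0 < ‖φ‖ := norm_pos_iff.2 hφ
  obtain ⟨⟨p, q⟩, ⟨⟨hp, hq⟩, hpq⟩, h⟩ := key (‖φ‖⁻¹ • φ) (by
    rw [norm_smul, norm_inv, norm_norm, inv_mul_cancel₀ hφ0.ne'])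
  refine ⟨‖φ‖ • WeakDual.toStrongDual p, ‖φ‖ • WeakDual.toStrongDual q,
    fun x hx => mul_nonneg hφ0.le (hp.2 x hx), fun x hx => mul_nonneg hφ0.le (hq.2 x hx), ?_, ?_⟩
  · ext x
    have h1 : p x - q x = ‖φ‖⁻¹ * φ x := congrArg (fun χ : WeakDual ℝ X => χ x) h
    change φ x = ‖φ‖ * p x - ‖φ‖ * q x
    rw [← mul_sub, h1, mul_inv_cancel_left₀ hφ0.ne']
  · rw [← smul_add, norm_smul, norm_norm]
    exact mul_le_of_le_one_right hφ0.le
      (norm_le_one_of_apply_le (φ := WeakDual.toStrongDual p + WeakDual.toStrongDual q) hpq.1)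

/-- The positive part of the unit ball has a weak* limit in the bidual along a finer filter. -/
theorem exists_bidual_limit [IsDirectedOrder (PosBall X)] :
    ∃ (E : StrongDual ℝ (StrongDual ℝ X)) (l : Filter (PosBall X)), l.NeBot ∧ l ≤ atTop ∧
      (∀ φ : StrongDual ℝ X, Tendsto (fun b : PosBall X => φ b) l (𝓝 (E φ))) ∧
      ∀ φ : StrongDual ℝ X, 0 ≤ φ → E φ = ‖φ‖ := by
  let U : Ultrafilter (PosBall X) := Ultrafilter.of atTop
  have hU : (U : Filter (PosBall X)) ≤ atTop := Ultrafilter.of_le _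
  let j : PosBall X → WeakDual ℝ (StrongDual ℝ X) := fun b =>
    StrongDual.toWeakDual (NormedSpace.inclusionInDoubleDual ℝ X b)
  have hj : ∀ b (φ : StrongDual ℝ X), j b φ = φ b := fun _ _ => rfl
  obtain ⟨E, -, hE⟩ := (isCompact_setOf_apply_le_norm (V := StrongDual ℝ X)).ultrafilter_le_nhds
    (U.map j) (by
      rw [Ultrafilter.coe_map, le_principal_iff, mem_map]
      refine Filter.univ_mem' fun b φ => ?_
      rw [hj]
      exact (le_abs_self _).trans ((φ.le_opNorm _).trans
        (mul_le_of_le_one_right (norm_nonneg _) b.2.2)))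
  have hlim : ∀ φ : StrongDual ℝ X, Tendsto (fun b : PosBall X => φ b) U (𝓝 (E φ)) := fun φ =>
    ((WeakDual.eval_continuous φ).tendsto E).comp (show Tendsto j U (𝓝 E) from hE)
  refine ⟨WeakDual.toStrongDual E, U, inferInstance, hU, hlim, fun φ hφ => ?_⟩
  exact tendsto_nhds_unique (hlim φ) ((isApproxOrderUnit_posBall.2 φ hφ).mono_left hU)

/-- `E` is the norm on the dual cone. The decomposition `φ = φ₁ - φ₂` bounds `|F φ|` by `E φ₁ + E φ₂
= ‖φ₁ + φ₂‖ ≤ ‖φ‖` for `F` in `[-E, E]`. -/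
theorem IsAMAlgebra.isOrderUnit_bidual (hX : IsAMAlgebra X) {E : StrongDual ℝ (StrongDual ℝ X)}
    (hE : ∀ φ : StrongDual ℝ X, 0 ≤ φ → E φ = ‖φ‖) : IsOrderUnit E := by
  intro F
  constructor
  · intro hF
    have h : ∀ φ : StrongDual ℝ X, 0 ≤ φ → |F φ| ≤ E φ := fun φ hφ => by
      rw [hE φ hφ]
      exact (F.le_opNorm φ).trans (mul_le_of_le_one_left (norm_nonneg _) hF)
    exact ⟨fun φ hφ => (abs_le.1 (h φ hφ)).1, fun φ hφ => (abs_le.1 (h φ hφ)).2⟩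
  · rintro ⟨h1, h2⟩
    refine F.opNorm_le_bound zero_le_one fun φ => ?_
    obtain ⟨φ₁, φ₂, hφ₁, hφ₂, rfl, hle⟩ := hX.exists_decomposition φ
    have h : E φ₁ + E φ₂ ≤ ‖φ₁ - φ₂‖ := by
      rw [← map_add, hE _ (add_nonneg hφ₁ hφ₂)]
      exact hle
    have a1 : -E φ₁ ≤ F φ₁ := h1 _ hφ₁
    have a2 : -E φ₂ ≤ F φ₂ := h1 _ hφ₂
    have b1 : F φ₁ ≤ E φ₁ := h2 _ hφ₁
    have b2 : F φ₂ ≤ E φ₂ := h2 _ hφ₂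
    rw [one_mul, Real.norm_eq_abs, map_sub, abs_le]
    constructor <;> linarith

theorem firstArens_nonneg (hP : IsLatticeAlgebraProduct P)
    {F G : StrongDual ℝ (StrongDual ℝ X)} (hF : 0 ≤ F) (hG : 0 ≤ G) :
    0 ≤ firstArens (toBounded hP) F G := by
  intro φ hφ
  have h : 0 ≤ arensAdjoint (arensAdjoint (toBounded hP)) G φ := fun a ha => by
    have h : 0 ≤ arensAdjoint (toBounded hP) φ a := fun b hb => hφ _ (hP.pos a b ha hb)
    exact hG _ h
  exact hF _ h

theorem firstArens_inclusion (hP : IsLatticeAlgebraProduct P) (x y : X) :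
    firstArens (toBounded hP) (NormedSpace.inclusionInDoubleDual ℝ X x)
      (NormedSpace.inclusionInDoubleDual ℝ X y) =
        NormedSpace.inclusionInDoubleDual ℝ X (P x y) := rfl

/-- The weak* limit of an approximate identity is an identity of the first Arens product. -/
theorem IsAMAlgebra.isAlgIdentity_firstArens (hX : IsAMAlgebra X) (hP : IsLatticeAlgebraProduct P)
    (hs : IsSubunital P) (hid : IsApproxIdentity P (fun b : PosBall X => (b : X)))
    {E : StrongDual ℝ (StrongDual ℝ X)} {l : Filter (PosBall X)} [l.NeBot] (hl : l ≤ atTop)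
    (hlim : ∀ φ : StrongDual ℝ X, Tendsto (fun b : PosBall X => φ b) l (𝓝 (E φ)))
    (hE : ∀ φ : StrongDual ℝ X, 0 ≤ φ → E φ = ‖φ‖) :
    IsAlgIdentity (firstArens (toBounded hP)).toLinearMap₁₂ E := by
  let N : StrongDual ℝ X → X → StrongDual ℝ X := fun φ a => arensAdjoint (toBounded hP) φ a
  have hEN : ∀ φ a, E (N φ a) = φ a := fun φ a =>
    tendsto_nhds_unique (hlim (N φ a))
      (((φ.continuous.tendsto a).comp (hid a).2).mono_left hl)
  have hleft : ∀ (G : StrongDual ℝ (StrongDual ℝ X)) (φ : StrongDual ℝ X), 0 ≤ φ →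
      firstArens (toBounded hP) E G φ = G φ := by
    intro G φ hφ
    -- `G` is only norm continuous, so `N φ b → φ` is needed in norm. Subunitality makes `φ - N φ b`
    -- positive, and its norm is then its value under `E`.
    have hdist : ∀ b : PosBall X, ‖N φ b - φ‖ = E φ - φ b := fun b => by
      have h1 : 0 ≤ φ - N φ b := fun x hx =>
        sub_nonneg.2 (apply_mono hφ (hs b x b.2.1 b.2.2 hx).1)
      rw [norm_sub_rev, ← hE _ h1, map_sub, hEN]
    have h1 : Tendsto (fun b : PosBall X => N φ b) l (𝓝 φ) := by
      rw [tendsto_iff_norm_sub_tendsto_zero]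
      simp only [hdist]
      simpa using (hlim φ).const_sub (E φ)
    exact tendsto_nhds_unique (hlim _) ((G.continuous.tendsto φ).comp h1)
  intro G
  constructor
  · ext φ
    obtain ⟨φ₁, φ₂, hφ₁, hφ₂, rfl, -⟩ := hX.exists_decomposition φ
    rw [map_sub, map_sub]
    exact congrArg₂ _ (hleft G φ₁ hφ₁) (hleft G φ₂ hφ₂)
  · ext φ
    exact congrArg G (ContinuousLinearMap.ext (hEN φ))

theorem inclusion_nonneg_iff (x : X) :
    0 ≤ NormedSpace.inclusionInDoubleDual ℝ X x ↔ 0 ≤ x :=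
  ⟨fun h => nonneg_of_forall_apply_nonneg fun φ hφ => h φ hφ, fun h _ hφ => hφ x h⟩

/-- The bidual of an AM-algebra with the first Arens product is a space of continuous functions. -/
theorem IsAMAlgebra.exists_bidual_continuousMap (hX : IsAMAlgebra X)
    (hP : IsLatticeAlgebraProduct P) (hs : IsSubunital P)
    (hid : IsApproxIdentity P (fun b : PosBall X => (b : X))) :
    ∃ E : StrongDual ℝ (StrongDual ℝ X), IsOrderUnit E ∧
      IsAlgIdentity (firstArens (toBounded hP)).toLinearMap₁₂ E ∧
      ∃ (K : Type u) (_ : TopologicalSpace K) (_ : CompactSpace K) (_ : T2Space K)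
        (J : StrongDual ℝ (StrongDual ℝ X) ≃ₗᵢ[ℝ] C(K, ℝ)), (∀ F G, J F ≤ J G ↔ F ≤ G) ∧
          ∀ F G, J (firstArens (toBounded hP) F G) = J F * J G := by
  have := hX.isDirectedOrder_posBall
  obtain ⟨E, l, _, hl, hlim, hE⟩ := exists_bidual_limit (X := X)
  have hu := hX.isOrderUnit_bidual hE
  have hi := hX.isAlgIdentity_firstArens hP hs hid hl hlim hE
  obtain ⟨K, _, _, _, J, h1, h2, -⟩ := hu.exists_continuousMap
    (fun F G hF hG => firstArens_nonneg hP hF hG) hi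
  exact ⟨E, hu, hi, K, _, ‹_›, ‹_›, J, h1, h2⟩

/-- `P` is commutative, so the second Arens product is the flip of the first, and the first is
commutative because `J` carries it to the product of `C(K)`. -/
theorem IsAMAlgebra.firstArens_eq_secondArens_and (hX : IsAMAlgebra X)
    (hP : IsLatticeAlgebraProduct P) (hs : IsSubunital P)
    (hmul : ∀ φ ∈ KOne X, ∀ x y, φ (P x y) = φ x * φ y)
    (hid : IsApproxIdentity P (fun b : PosBall X => (b : X))) :
    firstArens (toBounded hP) = secondArens (toBounded hP) ∧
      IsUnitalAMAlgebraProduct (firstArens (toBounded hP)).toLinearMap₁₂ := by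
  obtain ⟨E, hu, hi, K, _, _, _, J, h1, h2⟩ := hX.exists_bidual_continuousMap hP hs hid
  have hflip : (toBounded hP).flip = toBounded hP := by
    ext x y
    exact hX.eq_of_forall_apply_eq fun φ hφ => by
      rw [ContinuousLinearMap.flip_apply, toBounded_apply, toBounded_apply, hmul φ hφ, hmul φ hφ,
        mul_comm]
  refine ⟨?_, ⟨⟨?_, fun F G hF hG => firstArens_nonneg hP hF hG⟩, fun F G => ?_⟩, E, hu, hi⟩
  · rw [secondArens, hflip]
    refine ContinuousLinearMap.ext fun F => ContinuousLinearMap.ext fun G => J.injective ?_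
    rw [ContinuousLinearMap.flip_apply, h2, h2, mul_comm]
  · intro F G H
    refine J.injective ?_
    change J (firstArens (toBounded hP) (firstArens (toBounded hP) F G) H) =
      J (firstArens (toBounded hP) F (firstArens (toBounded hP) G H))
    rw [h2, h2, h2, h2, mul_assoc]
  · change ‖firstArens (toBounded hP) F G‖ ≤ _
    rw [← J.norm_map, h2, ← J.norm_map F, ← J.norm_map G]
    exact norm_mul_le _ _

/-- If the first Arens product makes the bidual an AM-algebra with unit, then the lattice
homomorphisms of norm one are multiplicative. -/
theorem apply_mul_of_isUnitalAMAlgebraProduct (hP : IsLatticeAlgebraProduct P)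
    (h : IsUnitalAMAlgebraProduct (firstArens (toBounded hP)).toLinearMap₁₂)
    {φ : StrongDual ℝ X} (hφ : φ ∈ KOne X) (x y : X) : φ (P x y) = φ x * φ y := by
  obtain ⟨-, E, hu, hi⟩ := h
  let ι := NormedSpace.inclusionInDoubleDual ℝ X
  have hle : ∀ a : X, ‖a‖ ≤ 1 → ι a ≤ E := fun a ha =>
    ((hu (ι a)).1 ((NormedSpace.double_dual_bound ℝ X a).trans ha)).2
  -- `ι a ≤ E` on the unit ball, and `E` is an identity; `ι` reflects the order.
  have hs : IsSubunital P := by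
    intro a x ha ha1 hx
    have hE := sub_nonneg.2 (hle a ha1)
    have hx' := (inclusion_nonneg_iff x).2 hx
    have h1 := firstArens_nonneg hP hE hx'
    have h2 := firstArens_nonneg hP hx' hE
    rw [map_sub, sub_apply, firstArens_inclusion] at h1
    rw [map_sub, firstArens_inclusion] at h2
    rw [show firstArens (toBounded hP) E (ι x) = ι x from (hi _).1, ← map_sub,
      inclusion_nonneg_iff, sub_nonneg] at h1
    rw [show firstArens (toBounded hP) (ι x) E = ι x from (hi _).2, ← map_sub,
      inclusion_nonneg_iff, sub_nonneg] at h2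
    exact ⟨h1, h2⟩
  have h0 := nonneg_of_mem_latticeHoms hφ.1
  obtain ⟨k, hk⟩ := hs.exists_apply_eq hP h0
    fun ψ h h' => exists_eq_mul_of_le_latticeHom hφ.1 h h'
  have hE1 : E φ = 1 := by
    refine le_antisymm ?_ ?_
    · rw [← hφ.2]
      exact (le_abs_self _).trans ((E.le_opNorm φ).trans
        (mul_le_of_le_one_left (norm_nonneg _) hu.norm_le_one))
    · rw [← hφ.2]
      refine (isLUB_range_posBall h0).2 ?_
      rintro _ ⟨b, rfl⟩
      exact hle b b.2.2 φ h0
  -- The first Arens product of `E` and `ι z`, evaluated at `φ`, is `E` applied to `(k * φ z) • φ`;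
  -- here `E φ = 1`.
  have hk1 : ∀ z, k * φ z = φ z := fun z => by
    have h1 : firstArens (toBounded hP) E (ι z) φ = φ z :=
      congrArg (fun F : StrongDual ℝ (StrongDual ℝ X) => F φ) (hi (ι z)).1
    have h2 : arensAdjoint (arensAdjoint (toBounded hP)) (ι z) φ = (k * φ z) • φ := by
      ext a
      change φ (P a z) = k * φ z * φ a
      rw [hk]
      ring
    change E (arensAdjoint (arensAdjoint (toBounded hP)) (ι z) φ) = φ z at h1
    rwa [h2, map_smul, hE1, smul_eq_mul, mul_one] at h1
  rw [hk, hk1]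

theorem isApproxIdentity_posBall_of_bidual [IsDirectedOrder (PosBall X)]
    {K : Type*} [TopologicalSpace K] [CompactSpace K]
    (J : StrongDual ℝ (StrongDual ℝ X) ≃ₗᵢ[ℝ] C(K, ℝ)) (hJ : ∀ F G, J F ≤ J G ↔ F ≤ G)
    (hmul : ∀ x y : X, J (NormedSpace.inclusionInDoubleDual ℝ X (P x y)) =
      J (NormedSpace.inclusionInDoubleDual ℝ X x) * J (NormedSpace.inclusionInDoubleDual ℝ X y)) :
    IsApproxIdentity P (fun b : PosBall X => (b : X)) := by
  let ι := NormedSpace.inclusionInDoubleDual ℝ X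
  let T : X →ₗ[ℝ] (K → ℝ) :=
    { toFun := fun x t => J (ι x) t
      map_add' := fun x y => funext fun t => by simp
      map_smul' := fun c x => funext fun t => by simp }
  have hT : ∀ x t, T x t = J (ι x) t := fun _ _ => rfl
  refine isApproxIdentity_posBall_of_representation T (fun x => ?_) (fun x c hc => ?_)
    (fun x y => funext fun t => by
      rw [Pi.mul_apply, hT, hT, hT, hmul, ContinuousMap.mul_apply])
  · rw [← inclusion_nonneg_iff, ← hJ, map_zero]
    rfl
  · rw [← (NormedSpace.inclusionInDoubleDualLi ℝ).norm_map, ← J.norm_map,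
      ContinuousMap.norm_le _ hc]
    rfl

end Bidual

/-! ### Normalisation, function representations and the unital case. -/

section Characterizations

variable {X : Type u} [NormedAddCommGroup X] [NormedSpace ℝ X] [Lattice X]
  [IsOrderedAddMonoid X] [IsOrderedModule ℝ X] [HasSolidNorm X] [CompleteSpace X]
  {P : X →ₗ[ℝ] X →ₗ[ℝ] X}

theorem forall_KStar_iff_forall_KOne :
    (∀ x y : X, ∀ φ ∈ KStar X, φ (P x y) = 1 / ‖φ‖ * φ x * φ y) ↔
      ∀ φ ∈ KOne X, ∀ x y : X, φ (P x y) = φ x * φ y := by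
  constructor
  · intro h φ hφ x y
    have hne : φ ≠ 0 := norm_ne_zero_iff.1 (hφ.2 ▸ one_ne_zero)
    rw [h x y φ ⟨hφ.1, hφ.2.le, hne⟩, hφ.2, div_one, one_mul]
  · rintro h x y φ ⟨hφ, -, hne⟩
    have h0 : 0 < ‖φ‖ := norm_pos_iff.2 hne
    have hi : 0 ≤ ‖φ‖⁻¹ := by positivity
    -- The factor `1 / ‖φ‖` in the formula is exactly what normalising `φ` produces.
    have hmem : ‖φ‖⁻¹ • φ ∈ KOne X := by
      refine ⟨fun x y => ?_, by rw [norm_smul, norm_inv, norm_norm, inv_mul_cancel₀ h0.ne']⟩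
      change ‖φ‖⁻¹ * φ (x ⊔ y) = ‖φ‖⁻¹ * φ x ⊔ ‖φ‖⁻¹ * φ y ∧
        ‖φ‖⁻¹ * φ (x ⊓ y) = ‖φ‖⁻¹ * φ x ⊓ ‖φ‖⁻¹ * φ y
      rw [(hφ x y).1, (hφ x y).2]
      exact ⟨mul_max_of_nonneg _ _ hi, mul_min_of_nonneg _ _ hi⟩
    have key : ‖φ‖⁻¹ * φ (P x y) = ‖φ‖⁻¹ * φ x * (‖φ‖⁻¹ * φ y) := h _ hmem x y
    field_simp at key ⊢
    linarith

theorem isApproxIdentity_posBall_of_continuousMap [IsDirectedOrder (PosBall X)] {K : Type*}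
    [TopologicalSpace K] [CompactSpace K] (T : X →ₗᵢ[ℝ] C(K, ℝ)) (hT : IsLatticeAlgebraHom P T) :
    IsApproxIdentity P (fun b : PosBall X => (b : X)) :=
  isApproxIdentity_posBall_of_isLatticeAlgebraHom T hT
    (fun x y t => by rw [map_add, ContinuousMap.add_apply])
    (fun c x t => by rw [map_smul, ContinuousMap.smul_apply, smul_eq_mul])
    (fun x c hc => by rw [← T.norm_map, ContinuousMap.norm_le _ hc]; rfl)

open scoped ZeroAtInfty in
theorem isApproxIdentity_posBall_of_zeroAtInfty [IsDirectedOrder (PosBall X)] {Ω : Type*}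
    [TopologicalSpace Ω] (T : X ≃ₗᵢ[ℝ] C₀(Ω, ℝ)) (hT : IsLatticeAlgebraHom P T) :
    IsApproxIdentity P (fun b : PosBall X => (b : X)) :=
  isApproxIdentity_posBall_of_isLatticeAlgebraHom T hT
    (fun x y t => by rw [map_add, ZeroAtInftyContinuousMap.add_apply])
    (fun c x t => by rw [map_smul, ZeroAtInftyContinuousMap.smul_apply, smul_eq_mul])
    (fun x c hc => by rw [← T.norm_map, zeroAtInfty_norm_le _ hc])

theorem IsOrderUnit.apply_eq_one {e : X} (he : IsOrderUnit e) {φ : StrongDual ℝ X}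
    (hφ : φ ∈ KOne X) : φ e = 1 := by
  have h0 := nonneg_of_mem_latticeHoms hφ.1
  refine le_antisymm ((apply_le_norm hφ.2.le e).trans he.norm_le_one) ?_
  rw [← hφ.2]
  refine (isLUB_range_posBall h0).2 ?_
  rintro _ ⟨b, rfl⟩
  exact apply_mono h0 ((he b).1 b.2.2).2

theorem IsOrderUnit.isSubunital {e : X} (he : IsOrderUnit e) (hP : IsLatticeAlgebraProduct P)
    (hid : IsAlgIdentity P e) : IsSubunital P := by
  intro a x _ ha1 hx
  have hae := sub_nonneg.2 ((he a).1 ha1).2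
  have h1 := hP.pos _ _ hae hx
  have h2 := hP.pos _ _ hx hae
  rw [map_sub, LinearMap.sub_apply, (hid x).1, sub_nonneg] at h1
  rw [map_sub, (hid x).2, sub_nonneg] at h2
  exact ⟨h1, h2⟩

theorem IsOrderUnit.apply_mul_of_isAlgIdentity {e : X} (he : IsOrderUnit e)
    (hP : IsLatticeAlgebraProduct P) (hid : IsAlgIdentity P e) {φ : StrongDual ℝ X}
    (hφ : φ ∈ KOne X) (x y : X) : φ (P x y) = φ x * φ y := by
  refine (he.isSubunital hP hid).apply_mul_of_tendsto hP (nonneg_of_mem_latticeHoms hφ.1)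
    -- The unit `e`, as a constant net over a point, serves as approximate identity.
    (fun ψ h h' => exists_eq_mul_of_le_latticeHom hφ.1 h h') (l := (pure () : Filter Unit))
    (e := fun _ => e) (fun x => ?_) ?_ x y
  · rw [(hid x).1]
    exact tendsto_const_nhds
  · rw [he.apply_eq_one hφ]
    exact tendsto_const_nhds

theorem IsOrderUnit.exists_isLatticeAlgebraHom {e : X} (he : IsOrderUnit e)
    (hP : IsLatticeAlgebraProduct P) (hid : IsAlgIdentity P e) :
    ∃ (K : Type u) (_ : TopologicalSpace K) (_ : CompactSpace K) (_ : T2Space K)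
      (J : X ≃ₗᵢ[ℝ] C(K, ℝ)), IsLatticeAlgebraHom P J := by
  obtain ⟨K, _, _, _, J, h1, h2, -⟩ := he.exists_continuousMap hP.pos hid
  refine ⟨K, _, ‹_›, ‹_›, J, fun x y t => ?_⟩
  -- An order isomorphism preserves suprema and infima automatically.
  let O : X ≃o C(K, ℝ) := ⟨J.toEquiv, fun {x y} => h1 x y⟩
  have hO : ∀ x, O x = J x := fun _ => rfl
  rw [← hO (x ⊔ y), ← hO (x ⊓ y), O.map_sup, O.map_inf, h2]
  exact ⟨rfl, rfl, rfl⟩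

end Characterizations

end AMAlg

/-! ### The equivalences. -/

open scoped ZeroAtInfty in
theorem theorem3p7 {X : Type u} [NormedAddCommGroup X] [NormedSpace ℝ X] [CompleteSpace X]
    [Lattice X] [IsOrderedAddMonoid X] [IsOrderedModule ℝ X] [HasSolidNorm X]
    (hX : AMAlg.IsAMAlgebra X) (P : X →ₗ[ℝ] X →ₗ[ℝ] X)
    (hP : AMAlg.IsLatticeAlgebraProduct P) :
    List.TFAE [
      -- `P` is the AM-algebra product
      AMAlg.IsAMAlgebraProduct P,
      -- `(B_X)_+` is an approximate algebraic identity for `P`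
      AMAlg.IsApproxIdentity P (fun b : AMAlg.PosBall X => (b : X)),
      -- the formula for `P` when `x` is identified with the function `φ ↦ φ x`
      ∀ x y : X, ∀ φ ∈ AMAlg.KStar X, φ (P x y) = 1 / ‖φ‖ * φ x * φ y,
      -- norm-one lattice homomorphisms are multiplicative
      ∀ φ ∈ AMAlg.KOne X, ∀ x y : X, φ (P x y) = φ x * φ y,
      -- `X` is a closed subalgebra of a `C(K)`
      ∃ (K : Type u) (_ : TopologicalSpace K) (_ : CompactSpace K) (_ : T2Space K)
        (A : NonUnitalSubalgebra ℝ C(K, ℝ)) (T : X →ₗᵢ[ℝ] C(K, ℝ)),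
        IsClosed (A : Set C(K, ℝ)) ∧ Set.range T = (A : Set C(K, ℝ)) ∧
          AMAlg.IsLatticeAlgebraHom P T,
      -- `X` is a closed ideal of a `C(K)`
      ∃ (K : Type u) (_ : TopologicalSpace K) (_ : CompactSpace K) (_ : T2Space K)
        (I : Ideal C(K, ℝ)) (T : X →ₗᵢ[ℝ] C(K, ℝ)),
        IsClosed (I : Set C(K, ℝ)) ∧ Set.range T = (I : Set C(K, ℝ)) ∧
          AMAlg.IsLatticeAlgebraHom P T,
      -- `X` is a `C₀(Ω)`
      ∃ (Ω : Type u) (_ : TopologicalSpace Ω) (_ : LocallyCompactSpace Ω) (_ : T2Space Ω)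
        (T : X ≃ₗᵢ[ℝ] C₀(Ω, ℝ)), AMAlg.IsLatticeAlgebraHom P T,
      -- the Arens products coincide and give an AM-algebra with unit
      AMAlg.firstArens (AMAlg.toBounded hP) = AMAlg.secondArens (AMAlg.toBounded hP) ∧
        AMAlg.IsUnitalAMAlgebraProduct (AMAlg.firstArens (AMAlg.toBounded hP)).toLinearMap₁₂,
      -- the canonical inclusion into the bidual, seen as a `C(K)`, is multiplicative
      ∃ (K : Type u) (_ : TopologicalSpace K) (_ : CompactSpace K) (_ : T2Space K)
        (J : StrongDual ℝ (StrongDual ℝ X) ≃ₗᵢ[ℝ] C(K, ℝ)),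
        (∀ F G : StrongDual ℝ (StrongDual ℝ X), J F ≤ J G ↔ F ≤ G) ∧
          ∀ x y : X, J (NormedSpace.inclusionInDoubleDual ℝ X (P x y)) =
            J (NormedSpace.inclusionInDoubleDual ℝ X x) *
              J (NormedSpace.inclusionInDoubleDual ℝ X y)] ∧
    ∀ e : X, AMAlg.IsOrderUnit e →
      List.TFAE [
        -- `P` is the AM-algebra product
        AMAlg.IsAMAlgebraProduct P,
        -- `e` is the algebraic identity of `P`
        AMAlg.IsAlgIdentity P e,
        -- `P` is the pointwise product of a `C(K)`
        ∃ (K : Type u) (_ : TopologicalSpace K) (_ : CompactSpace K) (_ : T2Space K)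
          (J : X ≃ₗᵢ[ℝ] C(K, ℝ)), AMAlg.IsLatticeAlgebraHom P J] := by
  have hdir := hX.isDirectedOrder_posBall
  obtain ⟨Q, hQ⟩ := id hX
  have h41 : (∀ φ ∈ AMAlg.KOne X, ∀ x y : X, φ (P x y) = φ x * φ y) →
      AMAlg.IsAMAlgebraProduct P := fun h => hQ.eq_of_apply_mul h ▸ hQ
  have h14 : AMAlg.IsAMAlgebraProduct P →
      ∀ φ ∈ AMAlg.KOne X, ∀ x y : X, φ (P x y) = φ x * φ y := fun h _ hφ => h.apply_mul hφ
  have h24 : AMAlg.IsApproxIdentity P (fun b : AMAlg.PosBall X => (b : X)) →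
      ∀ φ ∈ AMAlg.KOne X, ∀ x y : X, φ (P x y) = φ x * φ y := fun h _ hφ =>
    AMAlg.apply_mul_of_isApproxIdentity_posBall hP h hφ
  have h42 : (∀ φ ∈ AMAlg.KOne X, ∀ x y : X, φ (P x y) = φ x * φ y) →
      AMAlg.IsApproxIdentity P (fun b : AMAlg.PosBall X => (b : X)) := fun h => by
    obtain ⟨K, _, _, _, -, T, -, hT⟩ := hX.exists_representation h
    exact AMAlg.isApproxIdentity_posBall_of_continuousMap T hT
  constructor
  · tfae_have 1 → 4 := h14
    tfae_have 4 → 1 := h41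
    tfae_have 2 → 4 := h24
    tfae_have 4 → 2 := h42
    tfae_have 3 ↔ 4 := AMAlg.forall_KStar_iff_forall_KOne
    tfae_have 4 → 6 := hX.exists_closedIdeal
    tfae_have 6 → 5 := by
      rintro ⟨K, _, _, _, I, T, hI, hr, hT⟩
      exact ⟨K, _, ‹_›, ‹_›, { I with
        mul_mem' := fun _ hb => I.mul_mem_left _ hb
        smul_mem' := fun c f hf => by
          -- Real scalars act through constant functions, so an ideal is a linear subspace.
          rw [← smul_one_mul c f]
          exact I.mul_mem_left _ hf }, T, hI, hr, hT⟩
    tfae_have 5 → 2 := by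
      rintro ⟨K, _, _, _, A, T, -, -, hT⟩
      exact AMAlg.isApproxIdentity_posBall_of_continuousMap T hT
    tfae_have 4 → 7 := hX.exists_zeroAtInfty
    tfae_have 7 → 2 := by
      rintro ⟨Ω, _, _, _, T, hT⟩
      exact AMAlg.isApproxIdentity_posBall_of_zeroAtInfty T hT
    tfae_have 4 → 8 := fun h =>
      hX.firstArens_eq_secondArens_and hP (h41 h).isSubunital h (h42 h)
    tfae_have 8 → 4 := fun h _ hφ => AMAlg.apply_mul_of_isUnitalAMAlgebraProduct hP h.2 hφ
    tfae_have 4 → 9 := by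
      intro h
      obtain ⟨-, -, -, K, _, _, _, J, h1, h2⟩ :=
        hX.exists_bidual_continuousMap hP (h41 h).isSubunital (h42 h)
      exact ⟨K, _, ‹_›, ‹_›, J, h1, fun x y => by
        rw [← AMAlg.firstArens_inclusion hP, h2]⟩
    tfae_have 9 → 2 := by
      rintro ⟨K, _, _, _, J, h1, h2⟩
      exact AMAlg.isApproxIdentity_posBall_of_bidual J h1 h2
    tfae_finish
  · intro e he
    tfae_have 1 → 2 := fun h x => by
      constructor <;> refine hX.eq_of_forall_apply_eq fun φ hφ => ?_
      · rw [h14 h φ hφ, he.apply_eq_one hφ, one_mul]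
      · rw [h14 h φ hφ, he.apply_eq_one hφ, mul_one]
    tfae_have 2 → 1 := fun h => h41 fun _ hφ => he.apply_mul_of_isAlgIdentity hP h hφ
    tfae_have 2 → 3 := he.exists_isLatticeAlgebraHom hP
    tfae_have 3 → 1 := by
      rintro ⟨K, _, _, _, J, hJ⟩
      exact h41 (h24 (AMAlg.isApproxIdentity_posBall_of_continuousMap J.toLinearIsometry hJ))
    tfae_finish
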